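/- Let $S\subset\mathbb C$ be open with coordinate $s$, let $f:\mathcal X\to S$ be a proper holomorphic submersion of complex manifolds with $n$-dimensional fibers $\mathcal X_s=f^{-1}(s)$ (a holomorphic family of compact complex manifolds), and suppose that the fibers carry Kähler–Einstein metrics of constant $-1$ that depend differentiably on the parameter: there is a $C^\infty$ hermitian metric on the relative tangent bundle $\mathcal T_{\mathcal X/S}$ whose coefficients $g_{\alpha\bar\beta}(z,s)$, in local holomorphic coordinates $(z^1,\dots,z^n,s)$ of $\mathcal X$ with $s=f$, satisfy $$g_{\alpha\bar\beta}=\frac{\partial^2\log g}{\partial z^\alpha\,\partial\bar z^\beta},\qquad g:=\det(g_{\alpha\bar\beta}).$$ (Thus the forms $\omega_{\mathcal X_s}=\sqrt{-1}\,g_{\alpha\bar\beta}\,dz^\alpha\wedge d\bar z^\beta$ are Kähler with $\omega_{\mathcal X_s}=-\mathrm{Ric}(\omega_{\mathcal X_s})$, and the fibers are canonically polarized.) Let $\omega_{\mathcal X}=\sqrt{-1}\,\partial\bar\partial\log g(z,s)$, a well-defined real $(1,1)$-form on $\mathcal X$ with $\omega_{\mathcal X}|_{\mathcal X_s}=\omega_{\mathcal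 X_s}$, and let $\langle\cdot,\cdot\rangle_{\omega_{\mathcal X}}$ be the corresponding sesquilinear form on the holomorphic tangent spaces of $\mathcal X$. Then at every point of $\mathcal X$ there is a unique horizontal lift $v$ of $\partial/\partial s$, i.e. a unique $(1,0)$-vector $v$ with $f_*v=\partial/\partial s$ that is orthogonal to the fiber with respect to $\langle\cdot,\cdot\rangle_{\omega_{\mathcal X}}$, and the function $\varphi:=\langle v,v\rangle_{\omega_{\mathcal X}}$ is a real-valued $C^\infty$ function on $\mathcal X$. For every $s\in S$ the Kodaira–Spencer class $\rho_s(\partial/\partial s)\in H^1(\mathcal X_s,\mathcal T_{\mathcal X_s})$ has a unique harmonic representative $A_s=A_{s\bar\beta}^{\alpha}\,\partial_\alpha\,dz^{\bar\beta}$ with respect to $\omega_{\mathcal X_s}$, namely $A_s=\bar\partial v|_{\mathcal X_s}$, and the following elliptic equation holds on $\mathcal X_s$: $$(\square_{g,s}+\mathrm{id})\,\varphi(z,s)=\|A_s(z,s)\|^2 .$$ Here $\square_{g,s}\chi=-g^{\bar\beta\alpha}\,\partial_\alpha\partial_{\bar\beta}\chi$ is the Laplacian of $\mathcal X_s$ with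 non-negative eigenvalues, and $\|A_s\|^2=g_{\alpha\bar\gamma}\,g^{\bar\beta\delta}A_{s\bar\beta}^{\alpha}\overline{A_{s\bar\delta}^{\gamma}}$ is the pointwise norm. -/

import Mathlib

open Set Topology
open scoped Manifold ContDiff ComplexConjugate Matrix

noncomputable section

namespace KEFamily

/-- The model space `ℂⁿ × ℂ`, with coordinates `(z, s)`. -/
abbrev Model (n : ℕ) : Type := (Fin n → ℂ) × ℂ

/-- A holomorphic family of compact complex manifolds of dimension `n` over an open set `S ⊆ ℂ`:
a proper holomorphic submersion `f : X → S` from a complex manifold `X` of dimension `n + 1`. -/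
structure HolomorphicFamily (n : ℕ) (X : Type*) [TopologicalSpace X] [ChartedSpace (Model n) X]
    [IsManifold 𝓘(ℂ, Model n) ω X] where
  /-- The base. -/
  S : Set ℂ
  isOpen_S : IsOpen S
  /-- The projection; the coordinate `s` of `ℂ` is the parameter of the family. -/
  f : X → ℂ
  mapsTo : ∀ x, f x ∈ S
  isProper : IsProperMap (fun x ↦ (⟨f x, mapsTo x⟩ : S))
  isSubmersion : Manifold.IsSubmersion 𝓘(ℂ, Model n) 𝓘(ℂ, ℂ) ω f

variable {n : ℕ} {X : Type*} [TopologicalSpace X] [ChartedSpace (Model n) X]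
  [IsManifold 𝓘(ℂ, Model n) ω X]

/-- The holomorphic tangent space `T_x X`. -/
abbrev Tan (n : ℕ) {X : Type*} [TopologicalSpace X] [ChartedSpace (Model n) X] (x : X) : Type :=
  TangentSpace 𝓘(ℂ, Model n) x

/-- The differential `df_x : T_x X → ℂ`. -/
def HolomorphicFamily.df (F : HolomorphicFamily n X) (x : X) : Tan n x →L[ℂ] ℂ :=
  mfderiv 𝓘(ℂ, Model n) 𝓘(ℂ, ℂ) F.f x

/-- The vertical tangent space `ker df_x`, i.e. the tangent space at `x` of the fibre through `x`,
the fibre at `x` of the relative tangent bundle `T_{X/S}`. -/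
def HolomorphicFamily.Vert (F : HolomorphicFamily n X) (x : X) : Submodule ℂ (Tan n x) :=
  LinearMap.ker (F.df x : Tan n x →ₗ[ℂ] ℂ)

/-- Local holomorphic coordinates `(z, s)` on `X` whose last coordinate is the parameter
`s = f`. -/
structure AdaptedChart (F : HolomorphicFamily n X) where
  e : OpenPartialHomeomorph X (Model n)
  mem : e ∈ IsManifold.maximalAtlas 𝓘(ℂ, Model n) ω X
  snd_eq : ∀ y ∈ e.source, (e y).2 = F.f y

/-- Around every point there are local coordinates `(z, s)` as above. -/
theorem exists_adaptedChart (F : HolomorphicFamily n X) (x : X) :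
    ∃ c : AdaptedChart F, x ∈ c.e.source := by
  have h := (F.isSubmersion.isSubmersionAt x)
  obtain ⟨G, _, _, φ, ψ, hxφ, hxψ, hφ, hψ, hsub, L, hL⟩ := h
  -- the complement `G` is isomorphic to `ℂⁿ`
  have : FiniteDimensional ℂ G :=
    Module.Finite.of_surjective ((LinearMap.snd ℂ ℂ G).comp (L : Model n →ₗ[ℂ] ℂ × G))
      (Prod.snd_surjective.comp L.surjective)
  have hdim : Module.finrank ℂ G = n := by
    have h1 := L.toLinearEquiv.finrank_eq
    simp only [Module.finrank_prod, Module.finrank_self, Module.finrank_fin_fun] at h1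
    omega
  let M : G ≃L[ℂ] (Fin n → ℂ) := ContinuousLinearEquiv.ofFinrankEq (by simp [hdim])
  let L' : Model n ≃L[ℂ] (Fin n → ℂ) × ℂ :=
    (L.trans (ContinuousLinearEquiv.prodComm ℂ ℂ G)).trans
      (M.prodCongr (ContinuousLinearEquiv.refl ℂ ℂ))
  let K : OpenPartialHomeomorph (Model n) (Model n) :=
    L'.toHomeomorph.toOpenPartialHomeomorph ≫ₕ
      ((OpenPartialHomeomorph.refl (Fin n → ℂ)).prod ψ.symm)
  have hψ1 : ContDiffOn ℂ ω ψ ψ.source :=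
    contMDiffOn_iff_contDiffOn.mp (contMDiffOn_of_mem_maximalAtlas hψ)
  have hψ2 : ContDiffOn ℂ ω ψ.symm ψ.target :=
    contMDiffOn_iff_contDiffOn.mp (contMDiffOn_symm_of_mem_maximalAtlas hψ)
  have hK : ∀ q, K q = ((L' q).1, ψ.symm (L' q).2) := fun q ↦ rfl
  have hK' : ∀ q, K.symm q = L'.symm (q.1, ψ q.2) := fun q ↦ rfl
  have hKs : ∀ q, q ∈ K.source ↔ (L' q).2 ∈ ψ.target := fun q ↦ by simp [K]
  have hKt : ∀ q, q ∈ K.target ↔ q.2 ∈ ψ.source := fun q ↦ by simp [K]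
  have hL2 : ∀ y ∈ φ.source, (L' (φ y)).2 = ψ (F.f y) := fun y hy ↦ by
    have h2 := hL (x := φ y) (by simpa using φ.map_source hy)
    simp [φ.left_inv hy] at h2
    simpa [L'] using h2.symm
  have hcK : ContMDiffOn 𝓘(ℂ, Model n) 𝓘(ℂ, Model n) ω K K.source := by
    rw [contMDiffOn_iff_contDiffOn]
    refine ContDiffOn.congr (f := fun q ↦ ((L' q).1, ψ.symm (L' q).2)) ?_ fun q _ ↦ hK q
    exact (contDiff_fst.comp L'.contDiff).contDiffOn.prodMk
      (hψ2.comp (contDiff_snd.comp L'.contDiff).contDiffOn fun q hq ↦ (hKs q).1 hq)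
  have hcK' : ContMDiffOn 𝓘(ℂ, Model n) 𝓘(ℂ, Model n) ω K.symm K.target := by
    rw [contMDiffOn_iff_contDiffOn]
    refine ContDiffOn.congr (f := fun q ↦ L'.symm (q.1, ψ q.2)) ?_ fun q _ ↦ hK' q
    exact L'.symm.contDiff.comp_contDiffOn (contDiff_fst.contDiffOn.prodMk
      (hψ1.comp contDiff_snd.contDiffOn fun q hq ↦ (hKt q).1 hq))
  have hsrc : ∀ y ∈ φ.source, φ y ∈ K.source := fun y hy ↦ by
    rw [hKs, hL2 y hy]
    exact ψ.map_source (hsub hy)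
  refine ⟨⟨φ ≫ₕ K, ?_, ?_⟩, ?_⟩
  · refine OpenPartialHomeomorph.mem_maximalAtlas_of_contMDiffOn _ ?_ ?_
    · exact hcK.comp ((contMDiffOn_of_mem_maximalAtlas hφ).mono (by simp)) (by
        intro y hy; simpa using hy.2)
    · refine (contMDiffOn_symm_of_mem_maximalAtlas hφ).comp (hcK'.mono (by simp)) ?_
      intro y hy
      simpa using hy.2
  · intro y hy
    have hy' : y ∈ φ.source := by simpa using hy.1
    have h3 : ((φ ≫ₕ K) y).2 = ψ.symm (L' (φ y)).2 := rfl
    rw [h3, hL2 y hy', ψ.left_inv (hsub hy')]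
  · exact ⟨hxφ, hsrc x hxφ⟩

/-- A choice of coordinates `(z, s)` around `x`. -/
def adaptedChartAt (F : HolomorphicFamily n X) (x : X) : AdaptedChart F :=
  (exists_adaptedChart F x).choose

namespace AdaptedChart

variable {F : HolomorphicFamily n X} (c : AdaptedChart F)

/-- The components of a tangent vector at `x` in the coordinates `(z, s)`. -/
def comp (x : X) : Tan n x →L[ℂ] Model n :=
  mfderiv 𝓘(ℂ, Model n) 𝓘(ℂ, Model n) c.e x

/-- The tangent vector at the point with coordinates `p` that has components `w`. -/
def vec (p : Model n) : Model n →L[ℂ] Tan n (c.e.symm p) :=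
  mfderiv 𝓘(ℂ, Model n) 𝓘(ℂ, Model n) c.e.symm p

end AdaptedChart

/-- The direction of the coordinate `z^α`. -/
def dirZ (α : Fin n) : Model n := (Pi.single α 1, 0)

theorem vec_mem_vert {F : HolomorphicFamily n X} (c : AdaptedChart F) {p : Model n}
    (hp : p ∈ c.e.target) (α : Fin n) : c.vec p (dirZ α) ∈ F.Vert (c.e.symm p) := by
  have hx : c.e.symm p ∈ c.e.source := c.e.map_target hp
  have h1 : MDifferentiableAt 𝓘(ℂ, Model n) 𝓘(ℂ, Model n) c.e.symm p :=
    (contMDiffAt_symm_of_mem_maximalAtlas c.mem hp).mdifferentiableAt (by simp)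
  have h2 : MDifferentiableAt 𝓘(ℂ, Model n) 𝓘(ℂ, ℂ) F.f (c.e.symm p) :=
    F.isSubmersion.contMDiff.contMDiffAt.mdifferentiableAt (by simp)
  have h3 : (F.f ∘ c.e.symm) =ᶠ[𝓝 p] Prod.snd := by
    filter_upwards [c.e.open_target.mem_nhds hp] with q hq
    have := c.snd_eq _ (c.e.map_target hq)
    rw [c.e.right_inv hq] at this
    exact this.symm
  have h4 := mfderiv_comp p h2 h1
  rw [h3.mfderiv_eq, mfderiv_eq_fderiv, fderiv_snd] at h4
  have h5 := congrArg (fun T : Model n →L[ℂ] ℂ ↦ T (dirZ α)) h4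
  exact h5.symm

open Classical in
/-- The coordinate vector field `∂_α = ∂/∂z^α`, at the point with coordinates `p`. -/
def AdaptedChart.partialZ {F : HolomorphicFamily n X} (c : AdaptedChart F) (α : Fin n)
    (p : Model n) : F.Vert (c.e.symm p) :=
  if hp : p ∈ c.e.target then ⟨c.vec p (dirZ α), vec_mem_vert c hp α⟩ else 0

/-! ### Wirtinger derivatives -/

/-- The derivative `∂_v G (p) = (D G(p) v - i D G(p) (i v)) / 2`; for a coordinate direction `v` it
is `∂ G / ∂ v`. -/
def wirt (v : Model n) (G : Model n → ℂ) (p : Model n) : ℂ :=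
  (lineDeriv ℝ G p v - Complex.I * lineDeriv ℝ G p (Complex.I • v)) / 2

/-- The derivative `∂_{v̄} G (p) = (D G(p) v + i D G(p) (i v)) / 2`; for a coordinate direction `v`
it is `∂ G / ∂ v̄`. -/
def wirtBar (v : Model n) (G : Model n → ℂ) (p : Model n) : ℂ :=
  (lineDeriv ℝ G p v + Complex.I * lineDeriv ℝ G p (Complex.I • v)) / 2

/-- The form `∂∂̄ G` at `p` as a sesquilinear form: `(v, w) ↦ ∂_v ∂_{w̄} G (p)`. -/
def ddbar (G : Model n → ℂ) (p v w : Model n) : ℂ := wirt v (wirtBar w G) p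

/-! ### Families of Kähler-Einstein metrics -/

/-- A family of hermitian metrics on the fibres, smooth on the total space: a smooth hermitian
metric on the relative tangent bundle, linear in the first and antilinear in the second entry. -/
structure RelativeMetric (F : HolomorphicFamily n X) where
  form : ∀ x, F.Vert x →ₗ[ℂ] F.Vert x →ₛₗ[starRingEnd ℂ] ℂ
  hermitian : ∀ x u w, form x u w = conj (form x w u)
  pos : ∀ x u, u ≠ 0 → 0 < (form x u u).re
  smooth : ∀ (c : AdaptedChart F) (α β : Fin n),
    ContDiffOn ℝ ∞ (fun p ↦ form (c.e.symm p) (c.partialZ α p) (c.partialZ β p)) c.e.target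

variable {F : HolomorphicFamily n X}

/-- The matrix `(g_{αβ̄}(z, s))` of the metrics in the coordinates `c`. -/
def RelativeMetric.coeff (g : RelativeMetric F) (c : AdaptedChart F) (p : Model n) :
    Matrix (Fin n) (Fin n) ℂ :=
  Matrix.of fun α β ↦ g.form (c.e.symm p) (c.partialZ α p) (c.partialZ β p)

/-- The entry `g^{β̄α}` of the inverse matrix, so that `∑_α g^{β̄α} g_{αγ̄} = δ_{βγ}`. -/
def RelativeMetric.inv (g : RelativeMetric F) (c : AdaptedChart F) (p : Model n)
    (β α : Fin n) : ℂ := (g.coeff c p)⁻¹ β α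

/-- The function `log g`, `g = det (g_{αβ̄}(z, s))`, in the coordinates `c`. -/
def RelativeMetric.logDet (g : RelativeMetric F) (c : AdaptedChart F) (p : Model n) : ℂ :=
  (Real.log (g.coeff c p).det.re : ℂ)

/-- The Kähler-Einstein equation with constant `-1` on all fibres: with
`ω = √-1 g_{αβ̄} dz^α ∧ dz̄^β`, it reads `ω = -Ric(ω)`, i.e. `ω = √-1 ∂∂̄ log g` along the fibres.
(That the fibre metrics are Kähler is part of this equation.) -/
def RelativeMetric.IsKahlerEinstein (g : RelativeMetric F) : Prop :=
  ∀ (c : AdaptedChart F), ∀ p ∈ c.e.target, ∀ α β : Fin n,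
    g.coeff c p α β = ddbar (g.logDet c) p (dirZ α) (dirZ β)

/-- The form `ω_X = √-1 ∂∂̄ log g(z, s)` on the total space (the curvature form of the relative
canonical bundle), as the sesquilinear form `⟨u, w⟩` on `T_x X`. It is computed in coordinates
`(z, s)` around `x`; another choice of them changes `log g` by the logarithm of the squared modulus
of a holomorphic function without zeros, and does not change `∂∂̄ log g`. -/
def RelativeMetric.omega (g : RelativeMetric F) (x : X) (u w : Tan n x) : ℂ :=
  ddbar (g.logDet (adaptedChartAt F x)) ((adaptedChartAt F x).e x)
    ((adaptedChartAt F x).comp x u) ((adaptedChartAt F x).comp x w)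

/-- `v ∈ T_x X` is a horizontal lift of `∂/∂s`: it is mapped to `∂/∂s` and it is orthogonal to the
fibre with respect to `ω_X`. -/
def RelativeMetric.IsHorizontalLift (g : RelativeMetric F) (x : X) (v : Tan n x) : Prop :=
  F.df x v = 1 ∧ ∀ w ∈ F.Vert x, g.omega x v w = 0

/-- The Laplacian `□ χ = - g^{β̄α} ∂_α ∂_β̄ χ` of a function on the fibres, in the coordinates `c`. -/
def RelativeMetric.laplacian (g : RelativeMetric F) (c : AdaptedChart F) (χ : X → ℂ)
    (p : Model n) : ℂ :=
  -∑ α, ∑ β, g.inv c p β α * ddbar (χ ∘ c.e.symm) p (dirZ α) (dirZ β)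

/-! ### Forms of type `(0,1)` on the fibres with values in the tangent bundle -/

/-- (Not necessarily continuous) `(0,1)`-forms on the fibres with values in the holomorphic tangent
bundle of the fibres: antilinear endomorphisms of the vertical tangent spaces. -/
abbrev VForm (F : HolomorphicFamily n X) : Type _ :=
  ∀ x : X, F.Vert x →ₛₗ[starRingEnd ℂ] F.Vert x

/-- The coefficient `A^α_β̄` of `A = A^α_β̄ ∂_α dz̄^β` in the coordinates `c`. -/
def VForm.coeff (A : VForm F) (c : AdaptedChart F) (α β : Fin n) (p : Model n) : ℂ :=
  (c.comp (c.e.symm p) (A (c.e.symm p) (c.partialZ β p) : Tan n (c.e.symm p))).1 α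

/-- The function `G`, given in the coordinates `c`, is smooth on the fibre over `s`. -/
def SmoothOnFibre (c : AdaptedChart F) (s : ℂ) (G : Model n → ℂ) : Prop :=
  ContDiffOn ℝ ∞ (fun z : Fin n → ℂ ↦ G (z, s)) {z | (z, s) ∈ c.e.target}

/-- `A` is smooth on the fibre over `s`. -/
def VForm.IsSmooth (A : VForm F) (s : ℂ) : Prop :=
  ∀ (c : AdaptedChart F) (α β : Fin n), SmoothOnFibre c s (A.coeff c α β)

/-- The component `u^α` of a vector field (along the fibres) on the total space. -/
def vecCoeff (c : AdaptedChart F) (u : ∀ x : X, Tan n x) (α : Fin n) (p : Model n) : ℂ :=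
  (c.comp (c.e.symm p) (u (c.e.symm p))).1 α

/-- `u` is a smooth section of `T X` (of type `(1,0)`) along the fibre over `s` with constant
`∂/∂s`-component `a`. For `a = 1` it is a smooth lift `∂/∂s + b^α ∂_α` of `∂/∂s` along the fibre,
for `a = 0` it is a smooth vector field of type `(1,0)` on the fibre. -/
def IsSmoothLift (F : HolomorphicFamily n X) (s a : ℂ) (u : ∀ x : X, Tan n x) : Prop :=
  (∀ x, F.f x = s → F.df x (u x) = a) ∧
    ∀ (c : AdaptedChart F) (α : Fin n), SmoothOnFibre c s (vecCoeff c u α)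

/-- `B = ∂̄ u = (∂ u^α / ∂ z̄^β) ∂_α dz̄^β` on the fibre over `s`. -/
def IsDbar (s : ℂ) (u : ∀ x : X, Tan n x) (B : VForm F) : Prop :=
  ∀ (c : AdaptedChart F), ∀ p ∈ c.e.target, p.2 = s → ∀ α β : Fin n,
    B.coeff c α β p = wirtBar (dirZ β) (vecCoeff c u α) p

/-- `∂̄ A = 0` on the fibre over `s`. -/
def VForm.IsDbarClosed (A : VForm F) (s : ℂ) : Prop :=
  ∀ (c : AdaptedChart F), ∀ p ∈ c.e.target, p.2 = s → ∀ α β γ : Fin n,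
    wirtBar (dirZ γ) (A.coeff c α β) p = wirtBar (dirZ β) (A.coeff c α γ) p

/-- `A` and `B` have the same class in the Dolbeault cohomology group `H^{0,1}(X_s, T_{X_s})`,
which is `H¹(X_s, T_{X_s})`: they differ by `∂̄ w` for a smooth vector field `w` on the fibre. -/
def Cohomologous (s : ℂ) (A B : VForm F) : Prop :=
  ∃ (w : ∀ x : X, Tan n x) (C : VForm F), IsSmoothLift F s 0 w ∧ IsDbar s w C ∧
    ∀ x, F.f x = s → A x - B x = C x

/-- `A` is a smooth `∂̄`-closed form on the fibre over `s` that represents the Kodaira-Spencer class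
`ρ_s(∂/∂s) ∈ H¹(X_s, T_{X_s})`, the image of `∂/∂s` under the edge homomorphism of
`0 → T_{X/S} → T_X → f^* T_S → 0`, i.e. the class of `∂̄ u` for a smooth lift `u` of `∂/∂s`. -/
def VForm.RepresentsKodairaSpencer (A : VForm F) (s : ℂ) : Prop :=
  A.IsSmooth s ∧ A.IsDbarClosed s ∧
    ∃ (u : ∀ x : X, Tan n x) (B : VForm F), IsSmoothLift F s 1 u ∧ IsDbar s u B ∧
      Cohomologous s A B

/-- The Christoffel symbol `Γ^α_{γδ} = g^{ε̄α} ∂_γ g_{δε̄}` of the fibre metrics. -/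
def RelativeMetric.christoffel (g : RelativeMetric F) (c : AdaptedChart F) (p : Model n)
    (α γ δ : Fin n) : ℂ :=
  ∑ ε, g.inv c p ε α * wirt (dirZ γ) (fun q ↦ g.coeff c q δ ε) p

/-- The covariant derivative `A^α_{β̄;γ} = ∂_γ A^α_β̄ + Γ^α_{γδ} A^δ_β̄` along the fibres. -/
def RelativeMetric.covDeriv (g : RelativeMetric F) (A : VForm F) (c : AdaptedChart F)
    (p : Model n) (α β γ : Fin n) : ℂ :=
  wirt (dirZ γ) (A.coeff c α β) p + ∑ δ, g.christoffel c p α γ δ * A.coeff c δ β p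

/-- `∂̄^* A = -g^{β̄γ} A^α_{β̄;γ} ∂_α = 0` on the fibre over `s`. -/
def RelativeMetric.IsDbarCoclosed (g : RelativeMetric F) (A : VForm F) (s : ℂ) : Prop :=
  ∀ (c : AdaptedChart F), ∀ p ∈ c.e.target, p.2 = s → ∀ α : Fin n,
    -∑ β, ∑ γ, g.inv c p β γ * g.covDeriv A c p α β γ = 0

/-- `A` is, on the fibre over `s`, a harmonic representative of the Kodaira-Spencer class
`ρ_s(∂/∂s)`: it represents this class, and `∂̄ A = 0` and `∂̄^* A = 0`. -/
def RelativeMetric.IsHarmonicKodairaSpencer (g : RelativeMetric F) (s : ℂ) (A : VForm F) : Prop :=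
  A.RepresentsKodairaSpencer s ∧ g.IsDbarCoclosed A s

/-- The pointwise norm `‖A‖² = g_{αγ̄} g^{β̄δ} A^α_β̄ conj(A^γ_δ̄)`, in the coordinates `c`. -/
def RelativeMetric.normSq (g : RelativeMetric F) (c : AdaptedChart F) (A : VForm F)
    (p : Model n) : ℂ :=
  ∑ α, ∑ γ, ∑ β, ∑ δ, g.coeff c p α γ * g.inv c p β δ *
    A.coeff c α β p * conj (A.coeff c γ δ p)

end KEFamily

end

noncomputable section

namespace KEFamily

/-! ### Differential identities from the Monge–Ampère equation, in a commutative ring with commuting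
derivations. -/

section Algebra

variable {R : Type*} [CommRing R] {ι : Type*} [Fintype ι]

/-! Put G = log g. The Kähler–Einstein equation makes g_{αβ̄} the vertical complex Hessian of G,
while exp G = det(g_{αβ̄}). Differentiating the latter in any direction i, the parameter s included,
gives ∂_i G = tr(g⁻¹ ∂_i g). A further ∂̄_j gives `KEAlgebra.second_ke`.

Let V^i be the components of the horizontal lift v = ∂_s + v^α ∂_α, and let E_{β̄j̄} = V^i
G_{iβ̄j̄}. Differentiating the orthogonality V^i G_{iε̄} = 0 by ∂̄_β gives E_{β̄ε̄} = -g_{αε̄} ∂̄_β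
v^α, so E is, up to sign, ∂̄v with its upper index lowered. Contracting the twice differentiated
equation with V gives the identity behind both main claims, g^{β̄α} ∂_α E_{β̄j̄} = V^i G_{ij̄}
(`KEAlgebra.IsHorizontal.sum_sum_K_D_E`). For vertical j the right side is zero, which says ∂̄^*∂̄v
= 0; as ∂̄v is trivially closed, it is harmonic. For the elliptic equation, orthogonality gives ∂̄_β
φ = E_{β̄j̄} conj(V^j). Applying g^{β̄α} ∂_α, the derivatives of E sum to φ by the same identity and
those of conj(V) give -‖∂̄v‖² (`KEAlgebra.IsHorizontal.trace_ddbar`).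

Uniqueness is proved by a maximum principle rather than by integration. The difference of two
harmonic representatives is ∂̄w for a smooth vertical field w with ∂̄^*∂̄w = 0. The Bochner formula
`KEAlgebra.bochner`, with Ricci curvature -1, expresses the trace of the complex Hessian of |w|² as
|∂̄w|² + |∇w|² + |w|². At a maximum on the compact fibre that trace is not positive, so w = 0.

The identities hold in an abstract ring (`KEAlgebra`) and are applied to smooth functions on open
sets of coordinates (`RelativeMetric.keAlgebra`). Globally, a change of chart alters log g by
log|det J|² with J holomorphic, which ∂∂̄ kills, so ω_X can be computed in every chart
(`RelativeMetric.omega_eq`). Likewise ∂̄ passes through the holomorphic Jacobian, so ∂̄v is a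
well-defined form (`RelativeMetric.coeff_dbarForm`). -/

theorem derivation_prod {κ : Type*} [DecidableEq κ] (D : Derivation ℤ R R) (s : Finset κ)
    (f : κ → R) :
    D (∏ i ∈ s, f i) = ∑ j ∈ s, D (f j) * ∏ i ∈ s.erase j, f i := by
  induction s using Finset.induction_on with
  | empty => simp
  | insert a s ha ih =>
    rw [Finset.prod_insert ha, Derivation.leibniz, ih, Finset.sum_insert ha,
      Finset.erase_insert ha, smul_eq_mul, smul_eq_mul, add_comm, mul_comm (∏ i ∈ s, f i),
      Finset.mul_sum]
    congr 1
    refine Finset.sum_congr rfl fun j hj ↦ ?_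
    have hne : a ≠ j := fun h ↦ ha (h ▸ hj)
    rw [Finset.erase_insert_of_ne hne, Finset.prod_insert (by simp [ha])]
    ring

/-- Jacobi's formula. The Leibniz rule on each permutation product differentiates one column at a
time, and Cramer's rule recognises the determinant with one column replaced as a diagonal entry of
adj(M) · DM. -/
theorem derivation_det [DecidableEq ι] (D : Derivation ℤ R R) (M : Matrix ι ι R) :
    D M.det = (M.adjugate * M.map D).trace := by
  have h1 : (M.adjugate * M.map D).trace = ∑ j, (M.updateCol j fun i ↦ D (M i j)).det := by
    refine Finset.sum_congr rfl fun j _ ↦ ?_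
    rw [← Matrix.cramer_apply, Matrix.cramer_eq_adjugate_mulVec]
    rfl
  rw [h1, Matrix.det_apply, map_sum]
  simp_rw [Matrix.det_apply]
  rw [Finset.sum_comm]
  refine Finset.sum_congr rfl fun σ _ ↦ ?_
  have h2 : D (Equiv.Perm.sign σ • ∏ i, M (σ i) i) =
      Equiv.Perm.sign σ • D (∏ i, M (σ i) i) := by
    rcases Int.units_eq_one_or (Equiv.Perm.sign σ) with h | h <;> simp [h]
  rw [h2, derivation_prod, Finset.smul_sum]
  refine Finset.sum_congr rfl fun j _ ↦ ?_
  congr 1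
  rw [← Finset.mul_prod_erase _ _ (Finset.mem_univ j)]
  congr 1
  · simp
  · refine Finset.prod_congr rfl fun i hi ↦ ?_
    rw [Matrix.updateCol_ne (Finset.ne_of_mem_erase hi)]

theorem map_derivation_mul (D : Derivation ℤ R R) (M N : Matrix ι ι R) :
    (M * N).map D = M.map D * N + M * N.map D := by
  ext i j
  simp only [Matrix.map_apply, Matrix.mul_apply, map_sum, Derivation.leibniz, smul_eq_mul,
    Matrix.add_apply, ← Finset.sum_add_distrib]
  exact Finset.sum_congr rfl fun k _ ↦ by ring

theorem map_derivation_inv [DecidableEq ι] (D : Derivation ℤ R R) {h K : Matrix ι ι R}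
    (hK : K * h = 1) (hK' : h * K = 1) :
    K.map D = -(K * h.map D * K) := by
  have h1 := map_derivation_mul D K h
  have h0 : (1 : Matrix ι ι R).map D = 0 := by
    ext i j
    by_cases hij : i = j <;> simp [hij]
  rw [hK, h0] at h1
  have h2 : K.map D * h = -(K * h.map D) := (neg_eq_of_add_eq_zero_left h1.symm).symm
  calc K.map D = K.map D * (h * K) := by rw [hK', mul_one]
    _ = _ := by rw [← mul_assoc, h2, neg_mul]

theorem derivation_trace (D : Derivation ℤ R R) (M : Matrix ι ι R) :
    D M.trace = (M.map D).trace := by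
  simp [Matrix.trace, map_sum]

theorem sum_sum_comm (f : ι → ι → ι → ι → R) :
    ∑ a, ∑ b, ∑ c, ∑ d, f a b c d = ∑ c, ∑ d, ∑ a, ∑ b, f a b c d := by
  have := Finset.sum_comm (s := (Finset.univ : Finset (ι × ι)))
    (t := (Finset.univ : Finset (ι × ι))) (f := fun x y ↦ f x.1 x.2 y.1 y.2)
  simpa only [Fintype.sum_prod_type] using this

theorem sum_sum_mul_sum_mul (K : ι → ι → R) (f : ι → ι → ι → R) (g : ι → R) :
    ∑ β, ∑ γ, K β γ * ∑ ε, f β γ ε * g ε = ∑ ε, (∑ β, ∑ γ, K β γ * f β γ ε) * g ε := by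
  have := Finset.sum_comm (s := (Finset.univ : Finset (ι × ι)))
    (t := (Finset.univ : Finset ι)) (f := fun x ε ↦ K x.1 x.2 * (f x.1 x.2 ε * g ε))
  simpa only [Fintype.sum_prod_type, Finset.mul_sum, Finset.sum_mul, mul_assoc] using this

/-- Commuting holomorphic and antiholomorphic derivations `D i`, `Db i`, and a potential `G` whose
vertical complex Hessian `h` has inverse `K` and satisfies the logarithmically differentiated
Monge-Ampère equation `D_i G = tr (K D_i h)`. -/
structure KEAlgebra (R : Type*) [CommRing R] (ι : Type*) [Fintype ι] [DecidableEq ι] where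
  D : Option ι → Derivation ℤ R R
  Db : Option ι → Derivation ℤ R R
  comm_D : ∀ i j x, D i (D j x) = D j (D i x)
  comm_Db : ∀ i j x, Db i (Db j x) = Db j (Db i x)
  comm : ∀ i j x, D i (Db j x) = Db j (D i x)
  G : R
  h : Matrix ι ι R
  K : Matrix ι ι R
  h_eq : ∀ α β, h α β = D (some α) (Db (some β) G)
  K_mul : K * h = 1
  mul_K : h * K = 1
  ke : ∀ i, D i G = (K * h.map (D i)).trace

namespace KEAlgebra

variable [DecidableEq ι] (A : KEAlgebra R ι)

/-- Apply ∂̄_j to `ke` and use ∂̄K = -K (∂̄h) K. The indices may be the parameter direction, which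
is how the variation of the metrics in s enters. -/
theorem second_ke (i j : Option ι) :
    A.D i (A.Db j A.G) = (A.K * (A.h.map (A.D i)).map (A.Db j)).trace -
      (A.h.map (A.Db j) * A.K * A.h.map (A.D i) * A.K).trace := by
  rw [A.comm, A.ke, derivation_trace, map_derivation_mul,
    map_derivation_inv _ A.K_mul A.mul_K, Matrix.trace_add, neg_mul, Matrix.trace_neg]
  have h1 : (A.K * A.h.map (A.Db j) * A.K * A.h.map (A.D i)).trace =
      (A.h.map (A.Db j) * A.K * A.h.map (A.D i) * A.K).trace := by
    simp only [mul_assoc]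
    rw [Matrix.trace_mul_comm A.K]
    simp only [mul_assoc]
  rw [h1]
  ring

/-- The functions `E_{β̄ j̄} = V^i G_{i β̄ j̄}`. -/
def E (V : Option ι → R) (β j : Option ι) : R := ∑ i, V i * A.D i (A.Db β (A.Db j A.G))

/-- The vector field `V = ∂_s + V^α ∂_α` is orthogonal to the vertical directions. -/
structure IsHorizontal (V : Option ι → R) : Prop where
  none : V none = 1
  orth : ∀ ε : ι, ∑ i, V i * A.D i (A.Db (some ε) A.G) = 0

variable {A} {V W : Option ι → R}

theorem derivation_one (D : Derivation ℤ R R) {x : R} (hx : x = 1) : D x = 0 := by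
  rw [hx]; exact D.map_one_eq_zero

/-- The ∂̄_β-derivative of the orthogonality relation. The s-component of V is the constant 1, so
only vertical components are differentiated. -/
theorem IsHorizontal.E_eq (hV : A.IsHorizontal V) (β : Option ι) (ε : ι) :
    A.E V β (some ε) = -∑ α, A.Db β (V (some α)) * A.h α ε := by
  have h1 := congrArg (A.Db β) (hV.orth ε)
  simp only [map_sum, Derivation.leibniz, smul_eq_mul, map_zero, Finset.sum_add_distrib] at h1
  have h2 : A.E V β (some ε) = ∑ i, V i * A.Db β (A.D i (A.Db (some ε) A.G)) := by
    simp only [E, A.comm, ]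
  rw [h2, eq_neg_of_add_eq_zero_left h1, neg_inj, Fintype.sum_option,
    derivation_one _ hV.none, mul_zero, zero_add]
  exact Finset.sum_congr rfl fun α _ ↦ by rw [A.h_eq, mul_comm]

/-- The ∂_α-derivative of the orthogonality relation. It replaces the V-derivative of the metric by
-(∂V) h, which removes one factor K from the quadratic term of `second_ke`. -/
theorem IsHorizontal.sum_D_h (hV : A.IsHorizontal V) (α β : ι) :
    ∑ i, V i * A.D i (A.h α β) = -∑ γ, A.D (some α) (V (some γ)) * A.h γ β := by
  have h1 := congrArg (A.D (some α)) (hV.orth β)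
  simp only [map_sum, Derivation.leibniz, smul_eq_mul, map_zero, Finset.sum_add_distrib] at h1
  have h2 : ∑ i, V i * A.D i (A.h α β) =
      ∑ i, V i * A.D (some α) (A.D i (A.Db (some β) A.G)) := by
    simp only [A.h_eq, A.comm_D (some α)]
  rw [h2, eq_neg_of_add_eq_zero_left h1, neg_inj, Fintype.sum_option,
    derivation_one _ hV.none, mul_zero, zero_add]
  exact Finset.sum_congr rfl fun γ _ ↦ by rw [A.h_eq, mul_comm]

/-- Contract `second_ke` with V^i. By `sum_D_h` the quadratic term becomes tr(∂̄_j h K ∂V), and its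
sum with the linear term is the Leibniz expansion of K^{β̄α} ∂_α (V^i G_{iβ̄j̄}). Vertical j yields
coclosedness of ∂̄V; the sum over all j against conj(V^j) yields φ. -/
theorem IsHorizontal.sum_sum_K_D_E (hV : A.IsHorizontal V) (j : Option ι) :
    ∑ β, ∑ α, A.K β α * A.D (some α) (A.E V (some β) j) = ∑ i, V i * A.D i (A.Db j A.G) := by
  let P : Matrix ι ι R := Matrix.of fun α γ ↦ A.D (some α) (V (some γ))
  have hX : ∑ i, V i • A.h.map (A.D i) = -(P * A.h) := by
    ext α β
    simpa [Matrix.sum_apply, Matrix.mul_apply, P] using hV.sum_D_h α β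
  have h1 : ∑ i, V i * A.D i (A.Db j A.G) =
      (A.K * ∑ i, V i • (A.h.map (A.D i)).map (A.Db j)).trace +
        (A.h.map (A.Db j) * A.K * P).trace := by
    have h2 : (A.h.map (A.Db j) * A.K * P).trace =
        - (A.h.map (A.Db j) * A.K * (∑ i, V i • A.h.map (A.D i)) * A.K).trace := by
      rw [hX, mul_neg, neg_mul, Matrix.trace_neg, neg_neg, ← mul_assoc, mul_assoc _ A.h, A.mul_K,
        mul_one]
    rw [h2]
    simp only [A.second_ke, Matrix.mul_sum, Matrix.sum_mul, Matrix.trace_sum, mul_sub,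
      Finset.sum_sub_distrib, Matrix.mul_smul, Matrix.smul_mul, Matrix.trace_smul, smul_eq_mul]
    ring
  have h3 : (A.h.map (A.Db j) * A.K * P).trace =
      ∑ β, ∑ α, A.K β α * ∑ γ, A.D (some α) (V (some γ)) * A.Db j (A.h γ β) := by
    rw [mul_assoc, Matrix.trace_mul_comm, mul_assoc]
    simp [Matrix.trace, Matrix.mul_apply, P]
  rw [h1, h3]
  simp only [Matrix.trace, Matrix.diag, Matrix.mul_apply, Matrix.sum_apply, Matrix.smul_apply,
    Matrix.map_apply, smul_eq_mul, ← Finset.sum_add_distrib, ← mul_add]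
  refine Finset.sum_congr rfl fun β _ ↦ Finset.sum_congr rfl fun α _ ↦ ?_
  congr 1
  simp only [E, map_sum, Derivation.leibniz, smul_eq_mul, Finset.sum_add_distrib]
  congr 1
  · refine Finset.sum_congr rfl fun i _ ↦ ?_
    rw [A.h_eq, A.comm_Db (some β) j, A.comm i j, A.comm (some α) j, A.comm_D (some α) i]
  · rw [Fintype.sum_option, derivation_one _ hV.none, mul_zero, zero_add]
    refine Finset.sum_congr rfl fun γ _ ↦ ?_
    rw [A.h_eq, A.comm_Db (some β) j, A.comm (some γ) j, mul_comm]

/-- The second variation of the length `φ = ⟨V, V⟩`: with `W = conj V`,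
`g^{β̄α} φ_{αβ̄} = φ - ‖∂̄V‖²`. -/
theorem IsHorizontal.trace_ddbar (hV : A.IsHorizontal V) (hW : W Option.none = 1)
    (hW' : ∀ ε : ι, ∑ j, A.D (some ε) (A.Db j A.G) * W j = 0) :
    ∑ β, ∑ α, A.K β α * A.D (some α) (A.Db (some β)
        (∑ i, ∑ j, V i * A.D i (A.Db j A.G) * W j)) =
      (∑ i, ∑ j, V i * A.D i (A.Db j A.G) * W j) -
        ∑ β, ∑ α, ∑ γ, ∑ δ, A.K β α * (A.Db (some β) (V (some γ)) * A.h γ δ *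
          A.D (some α) (W (some δ))) := by
  have h1 : ∀ β : ι, A.Db (some β) (∑ i, ∑ j, V i * A.D i (A.Db j A.G) * W j) =
      ∑ j, A.E V (some β) j * W j := by
    intro β
    have e1 : ∀ i j, A.Db (some β) (V i * A.D i (A.Db j A.G) * W j) =
        V i * A.D i (A.Db (some β) (A.Db j A.G)) * W j +
        (A.Db (some β) (V i) * (A.D i (A.Db j A.G) * W j) +
          V i * A.D i (A.Db j A.G) * A.Db (some β) (W j)) := by
      intro i j
      simp only [Derivation.leibniz, smul_eq_mul, A.comm]
      ring
    simp only [map_sum, e1, Finset.sum_add_distrib]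
    -- ∂̄V is vertical and W is orthogonal to vertical directions; `e3` is the mirror statement for
    -- ∂̄W and V.
    have e2 : ∑ i, ∑ j, A.Db (some β) (V i) * (A.D i (A.Db j A.G) * W j) = 0 := by
      simp only [← Finset.mul_sum]
      rw [Fintype.sum_option, derivation_one _ hV.none, zero_mul, zero_add]
      simp [hW']
    have e3 : ∑ i, ∑ j, V i * A.D i (A.Db j A.G) * A.Db (some β) (W j) = 0 := by
      rw [Finset.sum_comm]
      simp only [← Finset.sum_mul]
      rw [Fintype.sum_option, derivation_one _ hW, mul_zero, zero_add]
      simp [hV.orth]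
    rw [e2, e3, Finset.sum_comm, add_zero, add_zero]
    simp only [E, Finset.sum_mul]
  have h2 : ∀ α β : ι, A.D (some α) (∑ j, A.E V (some β) j * W j) =
      (∑ j, A.D (some α) (A.E V (some β) j) * W j) -
        ∑ γ, ∑ δ, A.Db (some β) (V (some γ)) * A.h γ δ * A.D (some α) (W (some δ)) := by
    intro α β
    simp only [map_sum, Derivation.leibniz, smul_eq_mul, Finset.sum_add_distrib]
    rw [Fintype.sum_option, derivation_one _ hW, mul_zero, zero_add]
    simp only [hV.E_eq]
    rw [add_comm, sub_eq_add_neg]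
    congr 1
    · exact Finset.sum_congr rfl fun _ _ ↦ mul_comm _ _
    · rw [Finset.sum_comm]
      simp only [neg_mul, Finset.sum_mul, Finset.sum_neg_distrib]
  simp only [h1, h2, mul_sub, Finset.sum_sub_distrib, Finset.mul_sum]
  congr 1
  calc _ = ∑ j, (∑ β, ∑ α, A.K β α * A.D (some α) (A.E V (some β) j)) * W j := by
        simp only [Finset.sum_mul, ← mul_assoc]
        rw [Finset.sum_comm' (t' := Finset.univ) (s' := fun _ ↦ Finset.univ) (by simp)]
        conv_rhs => rw [Finset.sum_comm]
        rw [Finset.sum_comm]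
        refine Finset.sum_congr rfl fun β _ ↦ ?_
        rw [Finset.sum_comm]
    _ = _ := by
        simp only [hV.sum_sum_K_D_E, Finset.sum_mul]
        rw [Finset.sum_comm]

/-- `g_{αε̄} A^α_{β̄;γ} = ∂_γ (g_{αε̄} A^α_β̄)`. -/
theorem sum_h_covDeriv (A : KEAlgebra R ι) (D : Derivation ℤ R R) (B : ι → R) (ε : ι) :
    ∑ α, A.h α ε * (D (B α) + ∑ δ, (∑ μ, A.K μ α * D (A.h δ μ)) * B δ) =
      D (∑ α, A.h α ε * B α) := by
  have h1 : ∀ μ, ∑ α, A.K μ α * A.h α ε = (1 : Matrix ι ι R) μ ε := fun μ ↦ by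
    rw [← A.K_mul, Matrix.mul_apply]
  have h2 : ∑ α, A.h α ε * ∑ δ, (∑ μ, A.K μ α * D (A.h δ μ)) * B δ =
      ∑ δ, ∑ μ, (∑ α, A.K μ α * A.h α ε) * (D (A.h δ μ) * B δ) := by
    simp only [Finset.mul_sum, Finset.sum_mul]
    rw [Finset.sum_comm]
    refine Finset.sum_congr rfl fun δ _ ↦ ?_
    rw [Finset.sum_comm]
    exact Finset.sum_congr rfl fun μ _ ↦ Finset.sum_congr rfl fun α _ ↦ by ring
  simp only [mul_add, Finset.sum_add_distrib, h2, h1, Matrix.one_apply, ite_mul, one_mul, zero_mul,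
    Finset.sum_ite_eq', Finset.mem_univ, if_true, map_sum, Derivation.leibniz, smul_eq_mul]
  congr 1
  exact Finset.sum_congr rfl fun _ _ ↦ mul_comm _ _

theorem sum_K_mul_h (A : KEAlgebra R ι) (f : ι → R) (ν : ι) :
    ∑ α, A.K ν α * ∑ ε, A.h α ε * f ε = f ν := by
  have h1 : ∑ α, A.K ν α * ∑ ε, A.h α ε * f ε = A.K.mulVec (A.h.mulVec f) ν := rfl
  rw [h1, Matrix.mulVec_mulVec, A.K_mul, Matrix.one_mulVec]

theorem sum_mul_h_K (A : KEAlgebra R ι) (f : ι → R) (ν : ι) :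
    ∑ ε, (∑ α, f α * A.h α ε) * A.K ε ν = f ν := by
  have h1 : ∑ ε, (∑ α, f α * A.h α ε) * A.K ε ν = Matrix.vecMul (Matrix.vecMul f A.h) A.K ν := rfl
  rw [h1, Matrix.vecMul_vecMul, A.mul_K, Matrix.vecMul_one]

/-- The Einstein equation Ric = -h: the bracket is minus the curvature tensor. It is `second_ke` in
vertical directions, where the Kähler symmetries ∂_μ h_{γβ̄} = ∂_γ h_{μβ̄} and their conjugates,
consequences of the potential, move the trace onto the derivative indices. -/
theorem h_eq_sum (A : KEAlgebra R ι) (μ ε : ι) :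
    A.h μ ε = ∑ β, ∑ γ, A.K β γ * (A.Db (some β) (A.D (some γ) (A.h μ ε)) -
      ∑ ν, A.D (some γ) (A.h μ ν) * ∑ α, A.K ν α * A.Db (some β) (A.h α ε)) := by
  have h1 : ∀ γ β, A.D (some μ) (A.h γ β) = A.D (some γ) (A.h μ β) := fun γ β ↦ by
    rw [A.h_eq, A.h_eq, A.comm_D]
  have h2 : ∀ α β, A.Db (some ε) (A.h α β) = A.Db (some β) (A.h α ε) := fun α β ↦ by
    rw [A.h_eq, A.h_eq, A.comm, A.comm, A.comm_Db]
  have h3 : ∀ γ β, A.Db (some ε) (A.D (some γ) (A.h μ β)) =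
      A.Db (some β) (A.D (some γ) (A.h μ ε)) := fun γ β ↦ by
    rw [← A.comm, h2, A.comm]
  conv_lhs => rw [A.h_eq, A.second_ke, mul_assoc, mul_assoc, Matrix.trace_mul_comm (A.h.map _)]
  simp only [mul_sub, Finset.sum_sub_distrib, mul_assoc]
  simp only [Matrix.trace, Matrix.diag, Matrix.mul_apply, Matrix.map_apply, h1, h2, h3]

/-- The derivatives of `wb` cancel, leaving the zeroth-order curvature expression of `h_eq_sum`.
This is the commutator of covariant derivatives in the Bochner formula. -/
theorem sum_K_h_aux (A : KEAlgebra R ι) (wb : ι → R) (μ β γ : ι) :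
    A.Db (some β) (∑ ε, A.D (some γ) (A.h μ ε) * wb ε) -
      ∑ ε, A.D (some γ) (A.h μ ε) * ∑ α, A.K ε α * A.Db (some β) (∑ ν, A.h α ν * wb ν) =
    ∑ ε, (A.Db (some β) (A.D (some γ) (A.h μ ε)) -
      ∑ ν, A.D (some γ) (A.h μ ν) * ∑ α, A.K ν α * A.Db (some β) (A.h α ε)) * wb ε := by
  have h1 : ∀ ε, ∑ α, A.K ε α * A.Db (some β) (∑ ν, A.h α ν * wb ν) =
      A.Db (some β) (wb ε) + ∑ ν, (∑ α, A.K ε α * A.Db (some β) (A.h α ν)) * wb ν := by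
    intro ε
    rw [← A.sum_K_mul_h (fun ν ↦ A.Db (some β) (wb ν)) ε]
    simp only [map_sum, Derivation.leibniz, smul_eq_mul, Finset.sum_add_distrib, mul_add]
    congr 1
    simp only [Finset.sum_mul, Finset.mul_sum]
    rw [Finset.sum_comm]
    exact Finset.sum_congr rfl fun _ _ ↦ Finset.sum_congr rfl fun _ _ ↦ by ring
  simp only [h1]
  simp only [map_sum, Derivation.leibniz, smul_eq_mul, Finset.sum_add_distrib, mul_add,
    sub_mul, Finset.sum_sub_distrib]
  have h2 : ∑ ε, A.D (some γ) (A.h μ ε) *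
        ∑ ν, (∑ α, A.K ε α * A.Db (some β) (A.h α ν)) * wb ν =
      ∑ ε, (∑ ν, A.D (some γ) (A.h μ ν) * ∑ α, A.K ν α * A.Db (some β) (A.h α ε)) * wb ε := by
    simp only [Finset.sum_mul, Finset.mul_sum]
    rw [Finset.sum_comm]
    exact Finset.sum_congr rfl fun _ _ ↦ Finset.sum_congr rfl fun _ _ ↦
      Finset.sum_congr rfl fun _ _ ↦ by ring
  have h3 : ∑ ε, wb ε * A.Db (some β) (A.D (some γ) (A.h μ ε)) =
      ∑ ε, A.Db (some β) (A.D (some γ) (A.h μ ε)) * wb ε :=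
    Finset.sum_congr rfl fun _ _ ↦ mul_comm _ _
  rw [h2, h3]
  ring

/-- The vertical vector field `w` (with conjugate `wb`) satisfies a Bochner formula. -/
theorem bochner (A : KEAlgebra R ι) (w wb : ι → R) :
    ∑ β, ∑ γ, A.K β γ * A.D (some γ) (A.Db (some β) (∑ α, ∑ ε, w α * A.h α ε * wb ε)) =
      (∑ ε, (∑ β, ∑ γ, A.K β γ * A.D (some γ) (∑ α, A.h α ε * A.Db (some β) (w α))) * wb ε) +
      (∑ α, (∑ β, ∑ γ, A.K β γ * A.Db (some β) (∑ ε, A.h α ε * A.D (some γ) (wb ε))) * w α) +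
      (∑ β, ∑ γ, A.K β γ *
        ∑ α, ∑ ε, A.Db (some β) (w α) * A.h α ε * A.D (some γ) (wb ε)) +
      (∑ β, ∑ γ, A.K β γ * ∑ ε, ∑ α, A.D (some γ) (∑ μ, w μ * A.h μ ε) * A.K ε α *
        A.Db (some β) (∑ μ, A.h α μ * wb μ)) +
      ∑ α, ∑ ε, w α * A.h α ε * wb ε := by
  have h1 : ∀ β : ι, A.Db (some β) (∑ α, ∑ ε, w α * A.h α ε * wb ε) =
      (∑ ε, (∑ α, A.h α ε * A.Db (some β) (w α)) * wb ε) +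
        ∑ α, w α * A.Db (some β) (∑ ν, A.h α ν * wb ν) := by
    intro β
    have e1 : ∑ α, ∑ ε, w α * A.h α ε * wb ε = ∑ α, w α * ∑ ν, A.h α ν * wb ν := by
      simp only [Finset.mul_sum, mul_assoc]
    rw [e1, map_sum, add_comm]
    simp only [Derivation.leibniz, smul_eq_mul, Finset.sum_add_distrib]
    congr 1
    simp only [Finset.sum_mul]
    rw [Finset.sum_comm]
    exact Finset.sum_congr rfl fun _ _ ↦ Finset.sum_congr rfl fun _ _ ↦ by ring
  have h2 : ∀ β α γ : ι, A.D (some γ) (A.Db (some β) (∑ ν, A.h α ν * wb ν)) =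
      A.Db (some β) (∑ ε, A.h α ε * A.D (some γ) (wb ε)) +
        A.Db (some β) (∑ ε, A.D (some γ) (A.h α ε) * wb ε) := by
    intro β α γ
    rw [A.comm, ← map_add, ← Finset.sum_add_distrib, map_sum]
    simp only [Derivation.leibniz, smul_eq_mul, mul_comm (wb _)]
  -- Write w_ε̄ = w^μ h_{με̄}. Since ∇_γ w^α = (∂_γ w_ε̄) K^{ε̄α}, this is ∂_γ w = ∇_γ w - Γw.
  have h3 : ∀ γ α : ι, A.D (some γ) (w α) =
      ∑ ε, (A.D (some γ) (∑ μ, w μ * A.h μ ε) - ∑ μ, w μ * A.D (some γ) (A.h μ ε)) * A.K ε α := by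
    intro γ α
    rw [← A.sum_mul_h_K (fun μ ↦ A.D (some γ) (w μ)) α]
    refine Finset.sum_congr rfl fun ε _ ↦ ?_
    congr 1
    simp only [map_sum, Derivation.leibniz, smul_eq_mul, Finset.sum_add_distrib, add_sub_cancel_left,
      mul_comm (A.h _ _)]
  have h4 : ∀ β γ : ι, A.D (some γ) (A.Db (some β) (∑ α, ∑ ε, w α * A.h α ε * wb ε)) =
      (∑ ε, A.D (some γ) (∑ α, A.h α ε * A.Db (some β) (w α)) * wb ε) +
      (∑ α, A.Db (some β) (∑ ε, A.h α ε * A.D (some γ) (wb ε)) * w α) +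
      (∑ α, ∑ ε, A.Db (some β) (w α) * A.h α ε * A.D (some γ) (wb ε)) +
      (∑ ε, ∑ α, A.D (some γ) (∑ μ, w μ * A.h μ ε) * A.K ε α *
        A.Db (some β) (∑ μ, A.h α μ * wb μ)) +
      ∑ μ, w μ * (A.Db (some β) (∑ ε, A.D (some γ) (A.h μ ε) * wb ε) -
        ∑ ε, A.D (some γ) (A.h μ ε) * ∑ α, A.K ε α * A.Db (some β) (∑ ν, A.h α ν * wb ν)) := by
    intro β γ
    have e1 : ∑ α, A.D (some γ) (w α) * A.Db (some β) (∑ ν, A.h α ν * wb ν) =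
        (∑ ε, ∑ α, A.D (some γ) (∑ μ, w μ * A.h μ ε) * A.K ε α *
          A.Db (some β) (∑ μ, A.h α μ * wb μ)) -
        ∑ μ, w μ * ∑ ε, A.D (some γ) (A.h μ ε) *
          ∑ α, A.K ε α * A.Db (some β) (∑ ν, A.h α ν * wb ν) := by
      set N := fun α ↦ A.Db (some β) (∑ ν, A.h α ν * wb ν) with hN
      have e2 : ∑ μ, w μ * ∑ ε, A.D (some γ) (A.h μ ε) * ∑ α, A.K ε α * N α =
          ∑ α, ∑ ε, (∑ μ, w μ * A.D (some γ) (A.h μ ε)) * A.K ε α * N α := by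
        simp only [Finset.sum_mul, Finset.mul_sum]
        rw [Finset.sum_comm]
        conv_rhs => rw [Finset.sum_comm]
        refine Finset.sum_congr rfl fun ε _ ↦ ?_
        rw [Finset.sum_comm]
        exact Finset.sum_congr rfl fun _ _ ↦ Finset.sum_congr rfl fun _ _ ↦ by ring
      rw [e2, Finset.sum_comm (γ := ι), ← Finset.sum_sub_distrib]
      refine Finset.sum_congr rfl fun α _ ↦ ?_
      rw [h3, Finset.sum_mul, ← Finset.sum_sub_distrib]
      exact Finset.sum_congr rfl fun _ _ ↦ by ring
    have e3 : ∑ ε, (∑ α, A.h α ε * A.Db (some β) (w α)) * A.D (some γ) (wb ε) =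
        ∑ α, ∑ ε, A.Db (some β) (w α) * A.h α ε * A.D (some γ) (wb ε) := by
      simp only [Finset.sum_mul]
      rw [Finset.sum_comm]
      exact Finset.sum_congr rfl fun _ _ ↦ Finset.sum_congr rfl fun _ _ ↦ by ring
    rw [h1, map_add, map_sum, map_sum]
    simp only [Derivation.leibniz, smul_eq_mul, Finset.sum_add_distrib, h2, mul_add, mul_sub,
      Finset.sum_sub_distrib]
    rw [e3, Finset.sum_congr rfl fun α _ ↦ mul_comm (A.Db (some β) (∑ ν, A.h α ν * wb ν)) _, e1,
      Finset.sum_congr rfl fun ε _ ↦ mul_comm (wb ε) _,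
      Finset.sum_congr rfl fun α _ ↦ mul_comm (w α) (A.Db (some β) (∑ ε, A.h α ε * _))]
    ring
  -- The traced curvature term is exactly |w|², with positive sign because the Einstein constant is
  -- -1.
  have h5 : ∑ α, ∑ ε, w α * A.h α ε * wb ε = ∑ β, ∑ γ, A.K β γ *
      ∑ μ, w μ * (A.Db (some β) (∑ ε, A.D (some γ) (A.h μ ε) * wb ε) -
        ∑ ε, A.D (some γ) (A.h μ ε) * ∑ α, A.K ε α * A.Db (some β) (∑ ν, A.h α ν * wb ν)) := by
    simp only [A.sum_K_h_aux]
    have e1 : ∀ μ ε, w μ * A.h μ ε * wb ε = ∑ β, ∑ γ, A.K β γ * (w μ *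
        ((A.Db (some β) (A.D (some γ) (A.h μ ε)) - ∑ ν, A.D (some γ) (A.h μ ν) *
          ∑ α, A.K ν α * A.Db (some β) (A.h α ε)) * wb ε)) := by
      intro μ ε
      conv_lhs => rw [A.h_eq_sum μ ε]
      rw [Finset.mul_sum, Finset.sum_mul]
      refine Finset.sum_congr rfl fun β _ ↦ ?_
      rw [Finset.mul_sum, Finset.sum_mul]
      exact Finset.sum_congr rfl fun γ _ ↦ by ring
    simp only [e1]
    rw [sum_sum_comm]
    simp only [Finset.mul_sum]
  simp only [h4, mul_add, Finset.sum_add_distrib, ← h5]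
  rw [sum_sum_mul_sum_mul A.K
      (fun β γ ε ↦ A.D (some γ) (∑ α, A.h α ε * A.Db (some β) (w α))) wb,
    sum_sum_mul_sum_mul A.K
      (fun β γ α ↦ A.Db (some β) (∑ ε, A.h α ε * A.D (some γ) (wb ε))) w]

end KEAlgebra
end Algebra

/-! ### Wirtinger calculus on ℂⁿ × ℂ and its behaviour under holomorphic maps. -/

section Wirtinger

variable {n : ℕ}

/-- The operator `G ↦ (D G v + σ D G (i v)) / 2`, which is `∂_v` for `σ = -i` and `∂_{v̄}` for
`σ = i`. -/
def crDeriv (σ : ℂ) (v : Model n) (G : Model n → ℂ) (p : Model n) : ℂ :=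
  (lineDeriv ℝ G p v + σ * lineDeriv ℝ G p (Complex.I • v)) / 2

theorem wirt_eq_crDeriv (v : Model n) : wirt v = crDeriv (-Complex.I) v := by
  ext G p
  simp only [wirt, crDeriv]
  ring

theorem wirtBar_eq_crDeriv (v : Model n) : wirtBar v = crDeriv Complex.I v := rfl

variable {σ τ : ℂ} {v w p : Model n} {F G : Model n → ℂ} {U : Set (Model n)}

theorem crDeriv_eq (h : DifferentiableAt ℝ G p) :
    crDeriv σ v G p = (fderiv ℝ G p v + σ * fderiv ℝ G p (Complex.I • v)) / 2 := by
  rw [crDeriv, h.lineDeriv_eq_fderiv, h.lineDeriv_eq_fderiv]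

theorem crDeriv_congr (h : F =ᶠ[𝓝 p] G) : crDeriv σ v F p = crDeriv σ v G p := by
  rw [crDeriv, crDeriv, h.lineDeriv_eq, h.lineDeriv_eq]

theorem crDeriv_congr_of_eqOn (hU : IsOpen U) (h : EqOn F G U) (hp : p ∈ U) :
    crDeriv σ v F p = crDeriv σ v G p :=
  crDeriv_congr (h.eventuallyEq_of_mem (hU.mem_nhds hp))

theorem crDeriv_add (hF : DifferentiableAt ℝ F p) (hG : DifferentiableAt ℝ G p) :
    crDeriv σ v (fun q ↦ F q + G q) p = crDeriv σ v F p + crDeriv σ v G p := by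
  rw [crDeriv_eq hF, crDeriv_eq hG, crDeriv_eq (hF.fun_add hG), fderiv_fun_add hF hG]
  simp only [add_apply]
  ring

theorem crDeriv_mul (hF : DifferentiableAt ℝ F p) (hG : DifferentiableAt ℝ G p) :
    crDeriv σ v (fun q ↦ F q * G q) p = F p * crDeriv σ v G p + G p * crDeriv σ v F p := by
  rw [crDeriv_eq hF, crDeriv_eq hG, crDeriv_eq (hF.fun_mul hG), fderiv_fun_mul hF hG]
  simp only [add_apply, smul_apply, smul_eq_mul]
  ring

theorem crDeriv_const (a : ℂ) : crDeriv σ v (fun _ ↦ a) p = 0 := by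
  rw [crDeriv_eq (differentiableAt_const a)]
  simp

theorem crDeriv_sum {κ : Type*} (s : Finset κ) {f : κ → Model n → ℂ}
    (h : ∀ i ∈ s, DifferentiableAt ℝ (f i) p) :
    crDeriv σ v (fun q ↦ ∑ i ∈ s, f i q) p = ∑ i ∈ s, crDeriv σ v (f i) p := by
  classical
  induction s using Finset.induction_on with
  | empty => simpa using crDeriv_const 0
  | insert a s ha ih =>
    simp only [Finset.sum_insert ha]
    rw [crDeriv_add (h a (by simp)) (DifferentiableAt.fun_sum fun i hi ↦ h i (by simp [hi])),
      ih fun i hi ↦ h i (by simp [hi])]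

theorem fderiv_conj_comp (hG : DifferentiableAt ℝ G p) :
    fderiv ℝ (fun q ↦ conj (G q)) p = (Complex.conjCLE : ℂ →L[ℝ] ℂ).comp (fderiv ℝ G p) :=
  ((Complex.conjCLE : ℂ →L[ℝ] ℂ).hasFDerivAt.comp p hG.hasFDerivAt).fderiv

theorem differentiableAt_conj (hG : DifferentiableAt ℝ G p) :
    DifferentiableAt ℝ (fun q ↦ conj (G q)) p :=
  ((Complex.conjCLE : ℂ →L[ℝ] ℂ).hasFDerivAt.comp p hG.hasFDerivAt).differentiableAt

theorem crDeriv_conj (hG : DifferentiableAt ℝ G p) :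
    crDeriv σ v (fun q ↦ conj (G q)) p = conj (crDeriv (conj σ) v G p) := by
  rw [crDeriv_eq hG, crDeriv_eq (differentiableAt_conj hG), fderiv_conj_comp hG]
  simp [map_ofNat]

theorem contDiffOn_conj (hG : ContDiffOn ℝ ∞ G U) : ContDiffOn ℝ ∞ (fun q ↦ conj (G q)) U :=
  (Complex.conjCLE : ℂ →L[ℝ] ℂ).contDiff.comp_contDiffOn hG

theorem differentiableAt_of_contDiffOn (hU : IsOpen U) (hG : ContDiffOn ℝ ∞ G U) (hp : p ∈ U) :
    DifferentiableAt ℝ G p :=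
  (hG.contDiffAt (hU.mem_nhds hp)).differentiableAt (by simp)

theorem contDiffOn_fderiv_apply (hU : IsOpen U) (hG : ContDiffOn ℝ ∞ G U) (v : Model n) :
    ContDiffOn ℝ ∞ (fun q ↦ fderiv ℝ G q v) U :=
  (hG.fderiv_of_isOpen hU (by simp)).clm_apply contDiffOn_const

theorem contDiffOn_crDeriv (hU : IsOpen U) (hG : ContDiffOn ℝ ∞ G U) :
    ContDiffOn ℝ ∞ (crDeriv σ v G) U := by
  refine ContDiffOn.congr (f := fun p ↦ (fderiv ℝ G p v + σ * fderiv ℝ G p (Complex.I • v)) / 2)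
    ?_ fun q hq ↦ crDeriv_eq (differentiableAt_of_contDiffOn hU hG hq)
  exact ((contDiffOn_fderiv_apply hU hG v).add
    (contDiffOn_const.mul (contDiffOn_fderiv_apply hU hG _))).div_const _

theorem contDiffOn_wirtBar (hU : IsOpen U) (hG : ContDiffOn ℝ ∞ G U) :
    ContDiffOn ℝ ∞ (wirtBar v G) U := contDiffOn_crDeriv hU hG

theorem crDeriv_crDeriv (hU : IsOpen U) (hG : ContDiffOn ℝ ∞ G U) (hp : p ∈ U) :
    crDeriv σ v (crDeriv τ w G) p =
      (fderiv ℝ (fderiv ℝ G) p v w + τ * fderiv ℝ (fderiv ℝ G) p v (Complex.I • w) +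
        σ * (fderiv ℝ (fderiv ℝ G) p (Complex.I • v) w +
          τ * fderiv ℝ (fderiv ℝ G) p (Complex.I • v) (Complex.I • w))) / 4 := by
  have h1 : EqOn (crDeriv τ w G)
      (fun p ↦ (fderiv ℝ G p w + τ * fderiv ℝ G p (Complex.I • w)) / 2) U :=
    fun q hq ↦ crDeriv_eq (differentiableAt_of_contDiffOn hU hG hq)
  have h2 : DifferentiableAt ℝ (fderiv ℝ G) p :=
    ((hG.fderiv_of_isOpen (m := ∞) hU (by simp)).contDiffAt (hU.mem_nhds hp)).differentiableAt
      (by simp)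
  have h3 : HasFDerivAt (fun p ↦ (fderiv ℝ G p w + τ * fderiv ℝ G p (Complex.I • w)) / 2)
      ((2⁻¹ : ℂ) • ((fderiv ℝ (fderiv ℝ G) p).flip w +
        τ • (fderiv ℝ (fderiv ℝ G) p).flip (Complex.I • w))) p := by
    have e : ∀ u, HasFDerivAt (fun p ↦ fderiv ℝ G p u) ((fderiv ℝ (fderiv ℝ G) p).flip u) p :=
      fun u ↦ by simpa using h2.hasFDerivAt.clm_apply (hasFDerivAt_const u p)
    simp only [div_eq_inv_mul]
    exact ((e w).add ((e _).const_mul τ)).const_mul _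
  rw [crDeriv_congr_of_eqOn hU h1 hp, crDeriv_eq h3.differentiableAt, h3.fderiv]
  simp
  ring

/-- Symmetry of the second real derivative. With arbitrary σ and τ it covers ∂∂, ∂̄∂̄ and ∂∂̄ at
once. -/
theorem crDeriv_comm (hU : IsOpen U) (hG : ContDiffOn ℝ ∞ G U) (hp : p ∈ U) :
    crDeriv σ v (crDeriv τ w G) p = crDeriv τ w (crDeriv σ v G) p := by
  have h1 : IsSymmSndFDerivAt ℝ G p :=
    (hG.contDiffAt (hU.mem_nhds hp)).isSymmSndFDerivAt
      (by simpa using WithTop.coe_le_coe.2 (le_top : (2 : ℕ∞) ≤ ⊤))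
  rw [crDeriv_crDeriv hU hG hp, crDeriv_crDeriv hU hG hp, h1.eq w v, h1.eq (Complex.I • w) v,
    h1.eq w, h1.eq (Complex.I • w) (Complex.I • v)]
  ring

/-- The basis vectors of `ℂⁿ × ℂ`: the directions of `z^α` and (for `none`) of `s`. -/
def dir : Option (Fin n) → Model n
  | none => (0, 1)
  | some α => dirZ α

/-- The components of a vector of `ℂⁿ × ℂ`. -/
def coord (w : Model n) : Option (Fin n) → ℂ
  | none => w.2
  | some α => w.1 α

theorem sum_coord_smul_dir (w : Model n) : ∑ i, coord w i • dir i = w := by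
  rw [Fintype.sum_option]
  refine Prod.ext ?_ ?_
  · ext β
    simp [coord, dir, dirZ, Prod.fst_sum, Finset.sum_apply, Pi.single_apply]
  · simp [coord, dir, dirZ, Prod.snd_sum]

theorem smul_eq_re_add_im (a : ℂ) (v : Model n) :
    a • v = a.re • v + a.im • (Complex.I • v) := by
  conv_lhs => rw [← Complex.re_add_im a]
  rw [add_smul, mul_smul]
  simp only [Complex.coe_smul]

/-- The factor is a for σ = -i and conj(a) for σ = i: ∂_v is linear in v and ∂_{v̄} antilinear. -/
theorem crDeriv_smul (hσ : σ ^ 2 = -1) (hG : DifferentiableAt ℝ G p) (a : ℂ) :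
    crDeriv σ (a • v) G p = (a.re - σ * a.im) * crDeriv σ v G p := by
  have h1 : Complex.I • a • v = a.re • (Complex.I • v) + (-a.im) • v := by
    rw [smul_comm, smul_eq_re_add_im, ← mul_smul, Complex.I_mul_I]
    simp
  rw [crDeriv_eq hG, crDeriv_eq hG, h1, smul_eq_re_add_im]
  simp only [map_add, map_smul, Complex.real_smul, Complex.ofReal_neg]
  linear_combination ((a.im : ℂ) * fderiv ℝ G p (Complex.I • v) / 2) * hσ

theorem crDeriv_add_dir (hG : DifferentiableAt ℝ G p) :
    crDeriv σ (v + w) G p = crDeriv σ v G p + crDeriv σ w G p := by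
  rw [crDeriv_eq hG, crDeriv_eq hG, crDeriv_eq hG]
  simp only [smul_add, map_add]
  ring

theorem crDeriv_zero_dir : crDeriv σ 0 G p = 0 := by
  simp [crDeriv, lineDeriv]

theorem crDeriv_sum_dir {κ : Type*} (s : Finset κ) (f : κ → Model n)
    (hG : DifferentiableAt ℝ G p) :
    crDeriv σ (∑ i ∈ s, f i) G p = ∑ i ∈ s, crDeriv σ (f i) G p := by
  classical
  induction s using Finset.induction_on with
  | empty => simp [crDeriv_zero_dir]
  | insert a s ha ih => rw [Finset.sum_insert ha, crDeriv_add_dir hG, ih, Finset.sum_insert ha]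

theorem wirt_eq_sum (hG : DifferentiableAt ℝ G p) (v : Model n) :
    wirt v G p = ∑ i, coord v i * wirt (dir i) G p := by
  conv_lhs => rw [← sum_coord_smul_dir v]
  rw [wirt_eq_crDeriv, crDeriv_sum_dir _ _ hG]
  refine Finset.sum_congr rfl fun i _ ↦ ?_
  rw [crDeriv_smul (by simp) hG, wirt_eq_crDeriv]
  conv_rhs => rw [← Complex.re_add_im (coord v i)]
  ring

theorem wirtBar_eq_sum (hG : DifferentiableAt ℝ G p) (v : Model n) :
    wirtBar v G p = ∑ i, conj (coord v i) * wirtBar (dir i) G p := by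
  conv_lhs => rw [← sum_coord_smul_dir v]
  rw [wirtBar_eq_crDeriv, crDeriv_sum_dir _ _ hG]
  refine Finset.sum_congr rfl fun i _ ↦ ?_
  rw [crDeriv_smul (by simp) hG, wirtBar_eq_crDeriv]
  conv_rhs => rw [← Complex.re_add_im (coord v i)]
  simp only [map_add, map_mul, Complex.conj_ofReal, Complex.conj_I]
  ring

theorem wirt_conj (hG : DifferentiableAt ℝ G p) :
    wirt v (fun q ↦ conj (G q)) p = conj (wirtBar v G p) := by
  rw [wirt_eq_crDeriv, crDeriv_conj hG, wirtBar_eq_crDeriv]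
  simp

theorem wirtBar_conj (hG : DifferentiableAt ℝ G p) :
    wirtBar v (fun q ↦ conj (G q)) p = conj (wirt v G p) := by
  rw [wirtBar_eq_crDeriv, crDeriv_conj hG, wirt_eq_crDeriv]
  simp

theorem ddbar_eq_sum (hU : IsOpen U) (hG : ContDiffOn ℝ ∞ G U) (hp : p ∈ U) (v w : Model n) :
    ddbar G p v w = ∑ i, ∑ j, coord v i * ddbar G p (dir i) (dir j) * conj (coord w j) := by
  have h1 : EqOn (wirtBar w G) (fun q ↦ ∑ j, conj (coord w j) * wirtBar (dir j) G q) U :=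
    fun q hq ↦ wirtBar_eq_sum (differentiableAt_of_contDiffOn hU hG hq) w
  have h2 : ∀ j, DifferentiableAt ℝ (wirtBar (dir j) G) p := fun j ↦
    differentiableAt_of_contDiffOn hU (contDiffOn_wirtBar hU hG) hp
  have h3 : ∀ u, wirt u (wirtBar w G) p = ∑ j, ddbar G p u (dir j) * conj (coord w j) := by
    intro u
    rw [wirt_eq_crDeriv, crDeriv_congr_of_eqOn hU h1 hp,
      crDeriv_sum _ fun j _ ↦ (h2 j).const_mul _]
    refine Finset.sum_congr rfl fun j _ ↦ ?_
    rw [crDeriv_mul (differentiableAt_const _) (h2 j), crDeriv_const, ddbar, wirt_eq_crDeriv]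
    ring
  rw [ddbar, wirt_eq_sum (differentiableAt_of_contDiffOn hU (contDiffOn_wirtBar hU hG) hp)]
  simp only [h3, Finset.mul_sum, mul_assoc]

theorem conj_ddbar (hU : IsOpen U) (hG : ContDiffOn ℝ ∞ G U) (hp : p ∈ U)
    (hr : ∀ q ∈ U, conj (G q) = G q) (v w : Model n) :
    conj (ddbar G p v w) = ddbar G p w v := by
  have h1 : EqOn (fun q ↦ conj (wirtBar w G q)) (wirt w G) U := fun q hq ↦ by
    have hq' := differentiableAt_of_contDiffOn hU hG hq
    simp only
    rw [← wirt_conj hq', wirt_eq_crDeriv]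
    exact crDeriv_congr_of_eqOn hU hr hq
  rw [ddbar, ← wirtBar_conj (differentiableAt_of_contDiffOn hU (contDiffOn_wirtBar hU hG) hp),
    wirtBar_eq_crDeriv, crDeriv_congr_of_eqOn hU h1 hp, wirt_eq_crDeriv, crDeriv_comm hU hG hp,
    ddbar, wirt_eq_crDeriv, wirtBar_eq_crDeriv]

/-! ### Holomorphic functions and maps -/

theorem wirtBar_of_holomorphic (hF : DifferentiableAt ℂ F p) : wirtBar v F p = 0 := by
  rw [wirtBar_eq_crDeriv, crDeriv_eq (hF.restrictScalars ℝ), hF.fderiv_restrictScalars ℝ]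
  simp only [ContinuousLinearMap.coe_restrictScalars', map_smul, smul_eq_mul, ← mul_assoc,
    Complex.I_mul_I]
  ring

theorem crDeriv_comp_holomorphic {Φ : Model n → Model n} (hΦ : DifferentiableAt ℂ Φ p)
    (hG : DifferentiableAt ℝ G (Φ p)) :
    crDeriv σ v (fun q ↦ G (Φ q)) p = crDeriv σ (fderiv ℂ Φ p v) G (Φ p) := by
  have h1 := hG.hasFDerivAt.comp p (hΦ.restrictScalars ℝ).hasFDerivAt
  have h2 : crDeriv σ v (fun q ↦ G (Φ q)) p = _ := crDeriv_eq h1.differentiableAt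
  have h3 : fderiv ℝ (fun q ↦ G (Φ q)) p = _ := h1.fderiv
  rw [h2, h3, crDeriv_eq hG, hΦ.fderiv_restrictScalars ℝ]
  simp

/-- The chain rule for ∂̄ has antiholomorphic coefficients, which the outer ∂ kills, so no second
derivative of Φ appears. -/
theorem ddbar_comp_holomorphic {Φ : Model n → Model n} {U' : Set (Model n)} (hU : IsOpen U)
    (hU' : IsOpen U') (hΦ : ContDiffOn ℂ ω Φ U) (hm : MapsTo Φ U U') (hG : ContDiffOn ℝ ∞ G U')
    (hp : p ∈ U) :
    ddbar (fun q ↦ G (Φ q)) p v w = ddbar G (Φ p) (fderiv ℂ Φ p v) (fderiv ℂ Φ p w) := by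
  have hΦd : ∀ q ∈ U, DifferentiableAt ℂ Φ q := fun q hq ↦
    (hΦ.contDiffAt (hU.mem_nhds hq)).differentiableAt (by simp)
  have hc : ∀ j, DifferentiableAt ℂ (fun q ↦ coord (fderiv ℂ Φ q w) j) p := by
    intro j
    have h1 : DifferentiableAt ℂ (fun q ↦ fderiv ℂ Φ q w) p :=
      (((hΦ.fderiv_of_isOpen (m := ω) hU (by simp)).contDiffAt
        (hU.mem_nhds hp)).differentiableAt (by simp)).clm_apply (differentiableAt_const _)
    cases j with
    | none => exact h1.snd
    | some α => exact differentiableAt_pi.1 h1.fst α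
  have h1 : EqOn (wirtBar w fun q ↦ G (Φ q))
      (fun q ↦ ∑ j, conj (coord (fderiv ℂ Φ q w) j) * wirtBar (dir j) G (Φ q)) U := fun q hq ↦ by
    have hG' := differentiableAt_of_contDiffOn hU' hG (hm hq)
    simp only
    rw [wirtBar_eq_crDeriv, crDeriv_comp_holomorphic (hΦd q hq) hG', ← wirtBar_eq_crDeriv,
      wirtBar_eq_sum hG']
  have h2 : ∀ j, DifferentiableAt ℝ (wirtBar (dir j) G) (Φ p) := fun j ↦
    differentiableAt_of_contDiffOn hU' (contDiffOn_wirtBar hU' hG) (hm hp)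
  have h3 : ∀ j, DifferentiableAt ℝ (fun q ↦ wirtBar (dir j) G (Φ q)) p := fun j ↦
    (h2 j).comp p ((hΦd p hp).restrictScalars ℝ)
  have h4 : ∀ j, DifferentiableAt ℝ (fun q ↦ conj (coord (fderiv ℂ Φ q w) j)) p := fun j ↦
    differentiableAt_conj ((hc j).restrictScalars ℝ)
  rw [ddbar, wirt_eq_crDeriv, crDeriv_congr_of_eqOn hU h1 hp,
    crDeriv_sum _ fun j _ ↦ (h4 j).fun_mul (h3 j)]
  have h5 : ∀ j, crDeriv (-Complex.I) v (fun q ↦ conj (coord (fderiv ℂ Φ q w) j)) p = 0 := by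
    intro j
    rw [← wirt_eq_crDeriv, wirt_conj ((hc j).restrictScalars ℝ), wirtBar_of_holomorphic (hc j),
      map_zero]
  have h6 : EqOn (wirtBar (fderiv ℂ Φ p w) G)
      (fun q ↦ ∑ j, conj (coord (fderiv ℂ Φ p w) j) * wirtBar (dir j) G q) U' := fun q hq ↦
    wirtBar_eq_sum (differentiableAt_of_contDiffOn hU' hG hq) _
  rw [ddbar, wirt_eq_crDeriv, crDeriv_congr_of_eqOn hU' h6 (hm hp),
    crDeriv_sum _ fun j _ ↦ (h2 j).const_mul _]
  refine Finset.sum_congr rfl fun j _ ↦ ?_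
  rw [crDeriv_mul (h4 j) (h3 j), h5, crDeriv_mul (differentiableAt_const _) (h2 j), crDeriv_const,
    crDeriv_comp_holomorphic (hΦd p hp) (h2 j)]

/-- `∂∂̄ log |j|² = 0` for a holomorphic function `j` without zeros. -/
theorem ddbar_log_normSq {j : Model n → ℂ} (hU : IsOpen U) (hj : ContDiffOn ℂ ω j U)
    (h0 : ∀ q ∈ U, j q ≠ 0) (hp : p ∈ U) :
    ddbar (fun q ↦ (Real.log (Complex.normSq (j q)) : ℂ)) p v w = 0 := by
  have hjd : ∀ q ∈ U, DifferentiableAt ℂ j q := fun q hq ↦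
    (hj.contDiffAt (hU.mem_nhds hq)).differentiableAt (by simp)
  -- Dividing by j(p) puts the value at p at 1, so the principal logarithm is holomorphic nearby and
  -- log|j|² is L + conj(L) plus a constant.
  let V := U ∩ {q | j q / j p ∈ Complex.slitPlane}
  have hV : IsOpen V := by
    have h1 : ContinuousOn (fun q ↦ j q / j p) U :=
      (hj.continuousOn).div_const _
    exact h1.isOpen_inter_preimage hU Complex.isOpen_slitPlane
  have hpV : p ∈ V := ⟨hp, by simp [div_self (h0 p hp)]⟩
  let L : Model n → ℂ := fun q ↦ Complex.log (j q / j p)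
  have hL : ContDiffOn ℂ ω L V := by
    intro q hq
    exact ((analyticAt_clog hq.2).contDiffAt.comp q
      ((hj.contDiffAt (hU.mem_nhds hq.1)).div_const _)).contDiffWithinAt
  have hLd : ∀ q ∈ V, DifferentiableAt ℂ L q := fun q hq ↦
    (hL.contDiffAt (hV.mem_nhds hq)).differentiableAt (by simp)
  have h1 : EqOn (fun q ↦ (Real.log (Complex.normSq (j q)) : ℂ))
      (fun q ↦ (L q + conj (L q)) + (Real.log (Complex.normSq (j p)) : ℂ)) V := by
    intro q hq
    have hq0 := h0 q hq.1
    have hp0 := h0 p hp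
    simp only [L, Complex.add_conj, Complex.log_re]
    rw [norm_div, Real.log_div (by simpa) (by simpa), Complex.normSq_eq_norm_sq,
      Complex.normSq_eq_norm_sq, Real.log_pow, Real.log_pow]
    push_cast
    ring
  have h2 : EqOn (wirtBar w fun q ↦ (Real.log (Complex.normSq (j q)) : ℂ))
      (fun q ↦ conj (fderiv ℂ L q w)) V := by
    intro q hq
    have d1 := (hLd q hq).restrictScalars ℝ
    have d2 := differentiableAt_conj d1
    rw [wirtBar_eq_crDeriv, crDeriv_congr_of_eqOn hV h1 hq,
      crDeriv_add (d1.fun_add d2) (differentiableAt_const _), crDeriv_add d1 d2, crDeriv_const,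
      ← wirtBar_eq_crDeriv, wirtBar_of_holomorphic (hLd q hq), wirtBar_conj d1,
      wirt_eq_crDeriv, crDeriv_eq d1, (hLd q hq).fderiv_restrictScalars ℝ]
    simp only [ContinuousLinearMap.coe_restrictScalars', map_smul, smul_eq_mul, ← mul_assoc,
      neg_mul, Complex.I_mul_I]
    simp
  have h3 : DifferentiableAt ℂ (fun q ↦ fderiv ℂ L q w) p :=
    (((hL.fderiv_of_isOpen (m := ω) hV (by simp)).contDiffAt
      (hV.mem_nhds hpV)).differentiableAt (by simp)).clm_apply (differentiableAt_const _)
  rw [ddbar, wirt_eq_crDeriv, crDeriv_congr_of_eqOn hV h2 hpV, ← wirt_eq_crDeriv,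
    wirt_conj (h3.restrictScalars ℝ), wirtBar_of_holomorphic h3, map_zero]

end Wirtinger

/-! ### Smooth functions on an open set as a ring with Wirtinger derivations. -/

section SmoothRing

variable {n : ℕ} {U : Set (Model n)}

/-- Extension by zero of a function on an open set. -/
def extendZero (f : U → ℂ) : Model n → ℂ := Function.extend Subtype.val f 0

theorem extendZero_apply (f : U → ℂ) (p : U) : extendZero f p = f p :=
  Subtype.val_injective.extend_apply f 0 p

variable (U) in
/-- The ring of smooth functions on `U`. -/
def SmoothRing : Subring (U → ℂ) where
  carrier := {f | ContDiffOn ℝ ∞ (extendZero f) U}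
  mul_mem' {a b} ha hb := (ContDiffOn.mul ha hb).congr fun p hp ↦ by
    simpa [extendZero_apply] using extendZero_apply (a * b) ⟨p, hp⟩ |>.trans
      (by rw [Pi.mul_apply, ← extendZero_apply a, ← extendZero_apply b])
  one_mem' := (contDiffOn_const (c := (1 : ℂ))).congr fun p hp ↦ extendZero_apply 1 ⟨p, hp⟩
  add_mem' {a b} ha hb := (ContDiffOn.add ha hb).congr fun p hp ↦ by
    simpa [extendZero_apply] using extendZero_apply (a + b) ⟨p, hp⟩ |>.trans
      (by rw [Pi.add_apply, ← extendZero_apply a, ← extendZero_apply b])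
  zero_mem' := (contDiffOn_const (c := (0 : ℂ))).congr fun p hp ↦ extendZero_apply 0 ⟨p, hp⟩
  neg_mem' {a} ha := (ContDiffOn.neg ha).congr fun p hp ↦ by
    simpa [extendZero_apply] using extendZero_apply (-a) ⟨p, hp⟩ |>.trans
      (by rw [Pi.neg_apply, ← extendZero_apply a])

namespace SmoothRing

/-- Restriction of a function to `U`. -/
def of (F : Model n → ℂ) (hF : ContDiffOn ℝ ∞ F U) : SmoothRing U :=
  ⟨fun p ↦ F p, hF.congr fun p hp ↦ extendZero_apply _ ⟨p, hp⟩⟩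

/-- Evaluation at a point. -/
def eval (p : U) : SmoothRing U →+* ℂ := (Pi.evalRingHom (fun _ ↦ ℂ) p).comp (Subring.subtype _)

theorem eval_of (F : Model n → ℂ) (hF : ContDiffOn ℝ ∞ F U) (p : U) : eval p (of F hF) = F p := rfl

theorem ext_eval {f g : SmoothRing U} (h : ∀ p, eval p f = eval p g) : f = g :=
  Subtype.ext (funext h)

theorem extendZero_eq (f : SmoothRing U) (p : U) : extendZero f.1 p = eval p f :=
  extendZero_apply _ p

variable (hU : IsOpen U)

/-- The operators `crDeriv` as derivations. -/
def der (σ : ℂ) (v : Model n) : Derivation ℤ (SmoothRing U) (SmoothRing U) :=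
  Derivation.mk' (AddMonoidHom.toIntLinearMap
    { toFun f := of (crDeriv σ v (extendZero f.1)) (contDiffOn_crDeriv hU f.2)
      map_zero' := ext_eval fun p ↦ by
        rw [eval_of]
        refine (crDeriv_congr_of_eqOn (G := fun _ ↦ 0) hU
          (fun q hq ↦ extendZero_apply 0 ⟨q, hq⟩) p.2).trans ?_
        rw [crDeriv_const, map_zero]
      map_add' f g := ext_eval fun p ↦ by
        rw [map_add, eval_of, eval_of, eval_of, ← crDeriv_add
          (differentiableAt_of_contDiffOn hU f.2 p.2)
          (differentiableAt_of_contDiffOn hU g.2 p.2)]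
        exact crDeriv_congr_of_eqOn hU (fun q hq ↦ by
          have h := extendZero_eq (f + g) ⟨q, hq⟩
          rw [map_add, ← extendZero_eq, ← extendZero_eq] at h
          exact h) p.2 })
    fun f g ↦ ext_eval fun p ↦ by
      simp only [smul_eq_mul, map_add, map_mul]
      change crDeriv σ v (extendZero (f * g).1) p = eval p f * crDeriv σ v (extendZero g.1) p +
        eval p g * crDeriv σ v (extendZero f.1) p
      rw [← extendZero_eq f, ← extendZero_eq g, ← crDeriv_mul
          (differentiableAt_of_contDiffOn hU f.2 p.2)
          (differentiableAt_of_contDiffOn hU g.2 p.2)]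
      exact crDeriv_congr_of_eqOn hU (fun q hq ↦ by
          have h := extendZero_eq (f * g) ⟨q, hq⟩
          rw [map_mul, ← extendZero_eq, ← extendZero_eq] at h
          exact h) p.2

theorem der_of (σ : ℂ) (v : Model n) (F : Model n → ℂ) (hF : ContDiffOn ℝ ∞ F U) :
    der hU σ v (of F hF) = of (crDeriv σ v F) (contDiffOn_crDeriv hU hF) :=
  ext_eval fun p ↦ crDeriv_congr_of_eqOn hU (fun q hq ↦ extendZero_apply _ ⟨q, hq⟩) p.2

theorem exists_of (f : SmoothRing U) : ∃ (F : _) (hF : ContDiffOn ℝ ∞ F U), f = of F hF :=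
  ⟨_, f.2, ext_eval fun p ↦ (extendZero_eq f p).symm⟩

theorem of_congr {F G : Model n → ℂ} (hF : ContDiffOn ℝ ∞ F U) (hG : ContDiffOn ℝ ∞ G U)
    (h : EqOn F G U) : of F hF = of G hG := ext_eval fun p ↦ h p.2

theorem der_comm (σ τ : ℂ) (v w : Model n) (f : SmoothRing U) :
    der hU σ v (der hU τ w f) = der hU τ w (der hU σ v f) := by
  obtain ⟨F, hF, rfl⟩ := exists_of f
  simp only [der_of]
  exact of_congr _ _ fun p hp ↦ crDeriv_comm hU hF hp

theorem eval_der_of (σ : ℂ) (v : Model n) (F : Model n → ℂ) (hF : ContDiffOn ℝ ∞ F U) (p : U) :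
    eval p (der hU σ v (of F hF)) = crDeriv σ v F p := by
  rw [der_of, eval_of]

end SmoothRing
end SmoothRing

/-! ### Second-order conditions at a local maximum. -/

section LocalMax

variable {n : ℕ}

/-- If c were positive, 0 would also be a local minimum, so u would be locally constant and c would
vanish. -/
theorem deriv_deriv_nonpos_of_isLocalMax {u u' : ℝ → ℝ} {c : ℝ} (h : IsLocalMax u 0)
    (hu : ∀ᶠ t in 𝓝 0, HasDerivAt u (u' t) t) (hu' : HasDerivAt u' c 0) : c ≤ 0 := by
  by_contra! hc
  have h1 : deriv u =ᶠ[𝓝 0] u' := hu.mono fun t ht ↦ ht.deriv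
  have h2 : deriv (deriv u) 0 = c := by rw [h1.deriv_eq, hu'.deriv]
  have h3 : IsLocalMin u 0 := isLocalMin_of_deriv_deriv_pos (by rwa [h2]) h.deriv_eq_zero
    hu.self_of_nhds.continuousAt
  have h4 : u =ᶠ[𝓝 0] fun _ ↦ u 0 := by
    filter_upwards [h, h3] with t h5 h6 using le_antisymm h5 h6
  have h7 : deriv u =ᶠ[𝓝 0] fun _ ↦ 0 := by
    refine h4.deriv.trans (Filter.Eventually.of_forall fun t ↦ by simp)
  rw [h7.deriv_eq] at h2
  simp at h2
  exact hc.ne h2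

variable {U : Set (Model n)} {ψ : Model n → ℂ} {p : Model n}

theorem fderiv_fderiv_re_nonpos (hU : IsOpen U) (hψ : ContDiffOn ℝ ∞ ψ U) (hp : p ∈ U)
    (v : Model n) (hmax : IsLocalMax (fun t : ℝ ↦ (ψ (p + t • v)).re) 0) :
    (fderiv ℝ (fderiv ℝ ψ) p v v).re ≤ 0 := by
  have hl : ∀ t : ℝ, HasDerivAt (fun t : ℝ ↦ p + t • v) v t := fun t ↦ by
    simpa using ((hasDerivAt_id t).smul_const v).const_add p
  have hmem : ∀ᶠ t : ℝ in 𝓝 0, p + t • v ∈ U :=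
    (hl 0).continuousAt.eventually_mem (by simpa using hU.mem_nhds hp)
  refine deriv_deriv_nonpos_of_isLocalMax (u' := fun t ↦ (fderiv ℝ ψ (p + t • v) v).re) hmax ?_ ?_
  · filter_upwards [hmem] with t ht
    have h1 := (differentiableAt_of_contDiffOn hU hψ ht).hasFDerivAt.comp_hasDerivAt t (hl t)
    exact Complex.reCLM.hasFDerivAt.comp_hasDerivAt t h1
  · have h2 : DifferentiableAt ℝ (fderiv ℝ ψ) (p + (0 : ℝ) • v) := by
      rw [zero_smul, add_zero]
      exact ((hψ.fderiv_of_isOpen (m := ∞) hU (by simp)).contDiffAt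
        (hU.mem_nhds hp)).differentiableAt (by simp)
    have h3 := h2.hasFDerivAt.comp_hasDerivAt (0 : ℝ) (hl 0)
    have h4 := h3.clm_apply (hasDerivAt_const (0 : ℝ) v)
    have h5 := Complex.reCLM.hasFDerivAt.comp_hasDerivAt (0 : ℝ) h4
    rw [zero_smul, add_zero] at h5
    simp only [map_zero, add_zero] at h5
    exact h5

/-- ∂_v ∂_{v̄} is a quarter of the sum of the second derivatives along v and iv. Maxima along these
two lines suffice, which matters because only fibre directions are available later. -/
theorem ddbar_self_re_nonpos (hU : IsOpen U) (hψ : ContDiffOn ℝ ∞ ψ U) (hp : p ∈ U)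
    (v : Model n) (h1 : IsLocalMax (fun t : ℝ ↦ (ψ (p + t • v)).re) 0)
    (h2 : IsLocalMax (fun t : ℝ ↦ (ψ (p + t • Complex.I • v)).re) 0) :
    (ddbar ψ p v v).re ≤ 0 := by
  have h3 := fderiv_fderiv_re_nonpos hU hψ hp v h1
  have h4 := fderiv_fderiv_re_nonpos hU hψ hp _ h2
  have hs : IsSymmSndFDerivAt ℝ ψ p := (hψ.contDiffAt (hU.mem_nhds hp)).isSymmSndFDerivAt
    (by simpa using WithTop.coe_le_coe.2 (le_top : (2 : ℕ∞) ≤ ⊤))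
  have h5 : ddbar ψ p v v = (fderiv ℝ (fderiv ℝ ψ) p v v +
      fderiv ℝ (fderiv ℝ ψ) p (Complex.I • v) (Complex.I • v)) / 4 := by
    rw [ddbar, wirt_eq_crDeriv, wirtBar_eq_crDeriv, crDeriv_crDeriv hU hψ hp,
      hs.eq (Complex.I • v) v]
    linear_combination (-fderiv ℝ (fderiv ℝ ψ) p (Complex.I • v) (Complex.I • v) / 4) *
      Complex.I_mul_I
  rw [h5, show (4 : ℂ) = ((4 : ℝ) : ℂ) by norm_num, Complex.div_ofReal_re, Complex.add_re]
  linarith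

end LocalMax

/-! ### Positivity of traces and of norms defined by two hermitian forms. -/

section PosDef

open scoped ComplexOrder

variable {ι : Type*} [Fintype ι] [DecidableEq ι]

open scoped MatrixOrder in
-- With K = M^*M, cyclicity turns the trace into that of M P M^*, which is positive semidefinite.
theorem trace_mul_nonneg {K P : Matrix ι ι ℂ} (hK : K.PosSemidef) (hP : P.PosSemidef) :
    0 ≤ (K * P).trace := by
  obtain ⟨M, rfl⟩ := CStarAlgebra.nonneg_iff_eq_star_mul_self.mp hK.nonneg
  rw [mul_assoc, Matrix.trace_mul_comm]
  exact (hP.mul_mul_conjTranspose_same M).trace_nonneg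

/-- The squared norm of a matrix with respect to two positive semidefinite forms. -/
theorem sum_sum_form_nonneg {K h : Matrix ι ι ℂ} (hK : K.PosSemidef) (hh : h.PosSemidef)
    (B : ι → ι → ℂ) :
    0 ≤ ∑ β, ∑ γ, K β γ * ∑ α, ∑ ε, B γ α * h α ε * conj (B β ε) := by
  have h1 := trace_mul_nonneg hK (hh.mul_mul_conjTranspose_same (Matrix.of B))
  refine h1.trans_eq ?_
  simp only [Matrix.trace, Matrix.diag, Matrix.mul_apply, Matrix.conjTranspose_apply,
    Matrix.of_apply, Finset.sum_mul]
  refine Finset.sum_congr rfl fun β _ ↦ Finset.sum_congr rfl fun γ _ ↦ ?_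
  rw [Finset.sum_comm]
  rfl

/-- The other index order in K. The Bochner formula needs both: |∂̄w|² and |∇w|² contract K in
opposite orders. -/
theorem sum_sum_form_nonneg' {K h : Matrix ι ι ℂ} (hK : K.PosSemidef) (hh : h.PosSemidef)
    (B : ι → ι → ℂ) :
    0 ≤ ∑ β, ∑ γ, K β γ * ∑ α, ∑ ε, B β α * h α ε * conj (B γ ε) := by
  have h1 := trace_mul_nonneg hK (hh.mul_mul_conjTranspose_same (Matrix.of B)).transpose
  refine h1.trans_eq ?_
  simp only [Matrix.trace, Matrix.diag, Matrix.mul_apply, Matrix.conjTranspose_apply,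
    Matrix.transpose_apply, Matrix.of_apply, Finset.sum_mul]
  refine Finset.sum_congr rfl fun β _ ↦ Finset.sum_congr rfl fun γ _ ↦ ?_
  rw [Finset.sum_comm]
  rfl

end PosDef

/-! ### Changes of adapted coordinates, and independence of ω_X from the chart. -/

section Charts

variable {n : ℕ} {X : Type*} [TopologicalSpace X] [ChartedSpace (Model n) X]
  [IsManifold 𝓘(ℂ, Model n) ω X] {F : HolomorphicFamily n X}

namespace AdaptedChart

variable (c c' : AdaptedChart F) {x : X} {p : Model n}

theorem mdifferentiable : c.e.MDifferentiable 𝓘(ℂ, Model n) 𝓘(ℂ, Model n) :=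
  ⟨(contMDiffOn_of_mem_maximalAtlas c.mem).mdifferentiableOn (by simp),
    (contMDiffOn_symm_of_mem_maximalAtlas c.mem).mdifferentiableOn (by simp)⟩

theorem comp_bijective (hx : x ∈ c.e.source) : Function.Bijective (c.comp x) :=
  c.mdifferentiable.mfderiv_bijective hx

theorem comp_snd (hx : x ∈ c.e.source) (w : Tan n x) : (c.comp x w).2 = F.df x w := by
  have h1 : F.f =ᶠ[𝓝 x] Prod.snd ∘ c.e := by
    filter_upwards [c.e.open_source.mem_nhds hx] with y hy using (c.snd_eq y hy).symm
  have h2 : MDifferentiableAt 𝓘(ℂ, Model n) 𝓘(ℂ, ℂ) (Prod.snd : Model n → ℂ) (c.e x) :=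
    differentiableAt_snd.mdifferentiableAt
  have h3 := mfderiv_comp x h2 (c.mdifferentiable.mdifferentiableAt hx)
  rw [← h1.mfderiv_eq, mfderiv_eq_fderiv, fderiv_snd] at h3
  exact (congrArg (fun T : Tan n x →L[ℂ] ℂ ↦ T w) h3).symm

theorem comp_vec (hp : p ∈ c.e.target) (w : Model n) : c.comp (c.e.symm p) (c.vec p w) = w :=
  congrArg (fun T : Model n →L[ℂ] Model n ↦ T w) (c.mdifferentiable.comp_symm_deriv hp)

theorem mem_vert_iff (hx : x ∈ c.e.source) (w : Tan n x) :
    w ∈ F.Vert x ↔ (c.comp x w).2 = 0 := by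
  rw [c.comp_snd hx]
  exact LinearMap.mem_ker

theorem exists_frame (hx : x ∈ c.e.source) (α : Fin n) :
    ∃ u : F.Vert x, c.comp x (u : Tan n x) = dirZ α := by
  obtain ⟨u, hu⟩ := (c.comp_bijective hx).2 (dirZ α)
  exact ⟨⟨u, (c.mem_vert_iff hx u).2 (by rw [hu]; rfl)⟩, hu⟩

open Classical in
/-- The coordinate vector fields `∂_α`, indexed by the points of the manifold. -/
def frame (x : X) (α : Fin n) : F.Vert x :=
  if hx : x ∈ c.e.source then (c.exists_frame hx α).choose else 0

theorem comp_frame (hx : x ∈ c.e.source) (α : Fin n) :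
    c.comp x (c.frame x α : Tan n x) = dirZ α := by
  rw [frame, dif_pos hx]
  exact (c.exists_frame hx α).choose_spec

theorem ext_comp (hx : x ∈ c.e.source) {u w : Tan n x} (h : c.comp x u = c.comp x w) : u = w :=
  (c.comp_bijective hx).1 h

theorem vert_ext (hx : x ∈ c.e.source) {u w : F.Vert x}
    (h : ∀ α, (c.comp x (u : Tan n x)).1 α = (c.comp x (w : Tan n x)).1 α) : u = w := by
  refine Subtype.ext (c.ext_comp hx (Prod.ext (funext h) ?_))
  rw [(c.mem_vert_iff hx _).1 u.2, (c.mem_vert_iff hx _).1 w.2]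

/-- Passing to a frame indexed by points of X avoids transporting vectors along `c.e.symm (c.e x) =
x`. -/
theorem partialZ_eq_frame (hp : p ∈ c.e.target) (α : Fin n) :
    c.partialZ α p = c.frame (c.e.symm p) α := by
  rw [partialZ, dif_pos hp]
  refine Subtype.ext (c.ext_comp (c.e.map_target hp) ?_)
  rw [c.comp_frame (c.e.map_target hp), c.comp_vec hp]

theorem eq_sum_frame (hx : x ∈ c.e.source) (u : F.Vert x) :
    u = ∑ α, (c.comp x (u : Tan n x)).1 α • c.frame x α := by
  refine c.vert_ext hx fun β ↦ ?_
  simp only [Submodule.coe_sum, Submodule.coe_smul, map_sum, map_smul, c.comp_frame hx]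
  simp [dirZ, Prod.fst_sum, Finset.sum_apply, Pi.single_apply]

/-- The transition map between two charts. -/
def trans : Model n → Model n := fun p ↦ c'.e (c.e.symm p)

/-- The domain of the transition map. -/
def transDomain : TopologicalSpace.Opens (Model n) :=
  ⟨(c.e.symm ≫ₕ c'.e).source, (c.e.symm ≫ₕ c'.e).open_source⟩

variable {c c'}

theorem mem_transDomain : p ∈ c.transDomain c' ↔ p ∈ c.e.target ∧ c.e.symm p ∈ c'.e.source := by
  change p ∈ (c.e.symm ≫ₕ c'.e).source ↔ _
  simp

theorem mem_transDomain_of_mem_source (h : x ∈ c.e.source) (h' : x ∈ c'.e.source) :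
    c.e x ∈ c.transDomain c' :=
  mem_transDomain.2 ⟨c.e.map_source h, by rwa [c.e.left_inv h]⟩

theorem mapsTo_trans : MapsTo (c.trans c') (c.transDomain c') c'.e.target := fun _ hp ↦
  c'.e.map_source (mem_transDomain.1 hp).2

theorem symm_trans (hp : p ∈ c.transDomain c') : c'.e.symm (c.trans c' p) = c.e.symm p :=
  c'.e.left_inv (mem_transDomain.1 hp).2

theorem contDiffOn_trans : ContDiffOn ℂ ω (c.trans c') (c.transDomain c') := by
  rw [← contMDiffOn_iff_contDiffOn]
  exact (contMDiffOn_of_mem_maximalAtlas c'.mem).comp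
    ((contMDiffOn_symm_of_mem_maximalAtlas c.mem).mono fun p hp ↦ (mem_transDomain.1 hp).1)
    fun p hp ↦ (mem_transDomain.1 hp).2

theorem differentiableAt_trans (hp : p ∈ c.transDomain c') :
    DifferentiableAt ℂ (c.trans c') p :=
  (contDiffOn_trans.contDiffAt ((c.transDomain c').isOpen.mem_nhds hp)).differentiableAt (by simp)

theorem contDiffOn_fderiv_trans (w : Model n) :
    ContDiffOn ℂ ω (fun p ↦ fderiv ℂ (c.trans c') p w) (c.transDomain c') :=
  (contDiffOn_trans.fderiv_of_isOpen (c.transDomain c').isOpen (by simp)).clm_apply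
    contDiffOn_const

theorem comp_eq_fderiv_trans (h : x ∈ c.e.source) (h' : x ∈ c'.e.source) (w : Tan n x) :
    c'.comp x w = fderiv ℂ (c.trans c') (c.e x) (c.comp x w) := by
  have h1 : c'.e =ᶠ[𝓝 x] c.trans c' ∘ c.e := by
    filter_upwards [c.e.open_source.mem_nhds h] with y hy
    simp [trans, c.e.left_inv hy]
  have h2 := (differentiableAt_trans (mem_transDomain_of_mem_source h h')).mdifferentiableAt
  have h3 := mfderiv_comp x h2 (c.mdifferentiable.mdifferentiableAt h)
  rw [← h1.mfderiv_eq, mfderiv_eq_fderiv] at h3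
  exact congrArg (fun T : Tan n x →L[ℂ] Model n ↦ T w) h3

end AdaptedChart

/-! ### Smoothness of determinants and inverses -/

section Det

variable {𝕜 : Type*} [NontriviallyNormedField 𝕜] [NormedAlgebra 𝕜 ℂ] {E : Type*}
  [NormedAddCommGroup E] [NormedSpace 𝕜 E] {m : WithTop ℕ∞} {ι : Type*} [Fintype ι]
  [DecidableEq ι]

/-- The field and the smoothness order are left general because this serves both the real smooth
metric and the holomorphic Jacobian. -/
theorem contDiffOn_det {M : E → Matrix ι ι ℂ} {U : Set E}
    (h : ∀ i j, ContDiffOn 𝕜 m (fun p ↦ M p i j) U) : ContDiffOn 𝕜 m (fun p ↦ (M p).det) U := by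
  simp only [Matrix.det_apply, Units.smul_def, zsmul_eq_mul]
  exact ContDiffOn.sum fun σ _ ↦ contDiffOn_const.mul (contDiffOn_prod fun i _ ↦ h _ _)

theorem contDiffOn_matrix_inv {M : E → Matrix ι ι ℂ} {U : Set E}
    (h : ∀ i j, ContDiffOn 𝕜 m (fun p ↦ M p i j) U) (h0 : ∀ p ∈ U, (M p).det ≠ 0) (i j : ι) :
    ContDiffOn 𝕜 m (fun p ↦ (M p)⁻¹ i j) U := by
  have h1 : (fun p ↦ (M p)⁻¹ i j) =
      fun p ↦ ((M p).det)⁻¹ * ((M p).updateRow j (Pi.single i 1)).det := by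
    ext p
    rw [Matrix.inv_def, Matrix.smul_apply, Matrix.adjugate_apply, Ring.inverse_eq_inv, smul_eq_mul]
  rw [h1]
  refine ContDiffOn.mul ((contDiffOn_det h).inv h0) (contDiffOn_det fun k l ↦ ?_)
  by_cases hk : k = j
  · subst hk
    simpa using contDiffOn_const
  · simpa [Matrix.updateRow_ne hk] using h k l

end Det

/-! ### The metrics in coordinates -/

namespace RelativeMetric

open scoped ComplexOrder

variable (g : RelativeMetric F) (c c' : AdaptedChart F) {x : X} {p : Model n}

/-- The matrix of the metric in the frame of a chart, at a point of the manifold. -/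
def gram (x : X) : Matrix (Fin n) (Fin n) ℂ :=
  Matrix.of fun α β ↦ g.form x (c.frame x α) (c.frame x β)

theorem coeff_eq_gram (hp : p ∈ c.e.target) : g.coeff c p = g.gram c (c.e.symm p) := by
  ext α β
  simp only [coeff, gram, Matrix.of_apply, c.partialZ_eq_frame hp]

theorem form_eq_sum (hx : x ∈ c.e.source) (u w : F.Vert x) :
    g.form x u w = ∑ α, ∑ β, (c.comp x (u : Tan n x)).1 α * g.gram c x α β *
      conj ((c.comp x (w : Tan n x)).1 β) := by
  conv_lhs => rw [c.eq_sum_frame hx u, c.eq_sum_frame hx w]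
  simp only [map_sum, LinearMap.sum_apply, map_smul, LinearMap.smul_apply, map_smulₛₗ, smul_eq_mul,
    gram, Matrix.of_apply, Finset.mul_sum]
  rw [Finset.sum_comm]
  refine Finset.sum_congr rfl fun α _ ↦ Finset.sum_congr rfl fun β _ ↦ ?_
  ring

theorem form_self_nonneg (u : F.Vert x) (hu : u ≠ 0) : 0 < g.form x u u := by
  have h1 := g.hermitian x u u
  rw [Complex.lt_def]
  exact ⟨g.pos x u hu, (Complex.conj_eq_iff_im.1 h1.symm).symm⟩

theorem posDef_gram (hx : x ∈ c.e.source) : (g.gram c x).PosDef := by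
  refine Matrix.PosDef.of_dotProduct_mulVec_pos ?_ fun a ha ↦ ?_
  · ext α β
    exact (g.hermitian x _ _).symm
  -- The conjugate is needed because the form is linear in its first entry, whereas a^* M a is
  -- antilinear in the left vector.
  · let u : F.Vert x := ∑ α, conj (a α) • c.frame x α
    have hu : ∀ α, (c.comp x (u : Tan n x)).1 α = conj (a α) := fun β ↦ by
      simp only [u, Submodule.coe_sum, Submodule.coe_smul, map_sum, map_smul, c.comp_frame hx]
      simp [dirZ, Prod.fst_sum, Finset.sum_apply, Pi.single_apply]
    have hu0 : u ≠ 0 := fun h ↦ ha (funext fun α ↦ by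
      have h1 := hu α
      rw [h, Submodule.coe_zero, map_zero] at h1
      simpa using h1.symm)
    have h2 := g.form_self_nonneg u hu0
    rw [g.form_eq_sum c hx] at h2
    refine h2.trans_eq ?_
    simp only [hu, dotProduct, Matrix.mulVec, Finset.mul_sum, Pi.star_apply, Complex.conj_conj,
      mul_assoc]
    rfl

theorem posDef_coeff (hp : p ∈ c.e.target) : (g.coeff c p).PosDef := by
  rw [g.coeff_eq_gram c hp]
  exact g.posDef_gram c (c.e.map_target hp)

theorem det_coeff_pos (hp : p ∈ c.e.target) : 0 < (g.coeff c p).det :=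
  (g.posDef_coeff c hp).det_pos

theorem contDiffOn_coeff (α β : Fin n) :
    ContDiffOn ℝ ∞ (fun p ↦ g.coeff c p α β) c.e.target := g.smooth c α β

theorem contDiffOn_inv (α β : Fin n) :
    ContDiffOn ℝ ∞ (fun p ↦ g.inv c p α β) c.e.target :=
  contDiffOn_matrix_inv (g.contDiffOn_coeff c) (fun _ hp ↦ (g.det_coeff_pos c hp).ne') α β

theorem contDiffOn_logDet : ContDiffOn ℝ ∞ (g.logDet c) c.e.target := by
  have h1 : ContDiffOn ℝ ∞ (fun p ↦ (g.coeff c p).det.re) c.e.target :=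
    Complex.reCLM.contDiff.comp_contDiffOn (contDiffOn_det (g.contDiffOn_coeff c))
  exact Complex.ofRealCLM.contDiff.comp_contDiffOn
    (h1.log fun p hp ↦ (Complex.lt_def.1 (g.det_coeff_pos c hp)).1.ne')

theorem conj_logDet (p : Model n) : conj (g.logDet c p) = g.logDet c p := Complex.conj_ofReal _

/-- The Jacobian matrix of the transition map along the fibres. -/
def _root_.KEFamily.AdaptedChart.jac (p : Model n) : Matrix (Fin n) (Fin n) ℂ :=
  Matrix.of fun α γ ↦ (fderiv ℂ (c.trans c') p (dirZ α)).1 γ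

variable {c c'}

/-- Both charts have f as last coordinate, so coordinate fields ∂_α stay vertical and only the
vertical block of the derivative of the transition map enters. -/
theorem coeff_eq_mul (hp : p ∈ c.transDomain c') :
    g.coeff c p = c.jac c' p * g.coeff c' (c.trans c' p) * (c.jac c' p)ᴴ := by
  obtain ⟨h1, h2⟩ := AdaptedChart.mem_transDomain.1 hp
  rw [g.coeff_eq_gram c h1, g.coeff_eq_gram c' (AdaptedChart.mapsTo_trans hp),
    AdaptedChart.symm_trans hp]
  have h3 : ∀ α, c'.comp (c.e.symm p) (c.frame (c.e.symm p) α : Tan n _) =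
      fderiv ℂ (c.trans c') p (dirZ α) := fun α ↦ by
    rw [AdaptedChart.comp_eq_fderiv_trans (c.e.map_target h1) h2, c.comp_frame (c.e.map_target h1),
      c.e.right_inv h1]
  ext α β
  have h4 : g.gram c (c.e.symm p) α β = g.form _ _ _ := rfl
  rw [h4, g.form_eq_sum c' h2, Finset.sum_comm]
  simp only [Matrix.mul_apply, Matrix.conjTranspose_apply, Finset.sum_mul, h3, AdaptedChart.jac,
    Matrix.of_apply]
  rfl

/-- This determinant divides the positive determinant of the metric in the first chart. -/
theorem det_jac_ne_zero (g : RelativeMetric F) (hp : p ∈ c.transDomain c') : (c.jac c' p).det ≠ 0 := by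
  have h1 := (g.det_coeff_pos c (AdaptedChart.mem_transDomain.1 hp).1).ne'
  rw [g.coeff_eq_mul hp, Matrix.det_mul, Matrix.det_mul] at h1
  exact left_ne_zero_of_mul (left_ne_zero_of_mul h1)

theorem logDet_eq_add (hp : p ∈ c.transDomain c') :
    g.logDet c p = (Real.log (Complex.normSq (c.jac c' p).det) : ℂ) +
      g.logDet c' (c.trans c' p) := by
  have h1 : (g.coeff c p).det.re =
      Complex.normSq (c.jac c' p).det * (g.coeff c' (c.trans c' p)).det.re := by
    rw [g.coeff_eq_mul hp, Matrix.det_mul, Matrix.det_mul, Matrix.det_conjTranspose, mul_right_comm,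
      Complex.star_def, Complex.mul_conj, Complex.re_ofReal_mul]
  rw [logDet, h1, Real.log_mul, logDet]
  · push_cast; rfl
  · simpa using g.det_jac_ne_zero hp
  · exact (Complex.lt_def.1 (g.det_coeff_pos c' (AdaptedChart.mapsTo_trans hp))).1.ne'

theorem contDiffOn_det_jac :
    ContDiffOn ℂ ω (fun p ↦ (c.jac c' p).det) (c.transDomain c') :=
  contDiffOn_det fun α γ ↦
    contDiffOn_pi.1 (AdaptedChart.contDiffOn_fderiv_trans (dirZ α)).fst γ

/-- By `logDet_eq_add` the potentials differ by log|det J|² with det J holomorphic and nowhere zero.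
That term has ∂∂̄ = 0, and ∂∂̄ commutes with pullback by the transition map. -/
theorem ddbar_logDet_trans (hp : p ∈ c.transDomain c') (v w : Model n) :
    ddbar (g.logDet c) p v w = ddbar (g.logDet c') (c.trans c' p)
      (fderiv ℂ (c.trans c') p v) (fderiv ℂ (c.trans c') p w) := by
  have hU := (c.transDomain c').isOpen
  have hs : ContDiffOn ℝ ∞ (fun q ↦ g.logDet c' (c.trans c' q)) (c.transDomain c') :=
    (g.contDiffOn_logDet c').comp
      ((AdaptedChart.contDiffOn_trans.restrict_scalars ℝ).of_le le_top) AdaptedChart.mapsTo_trans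
  have hs' : ContDiffOn ℝ ∞ (g.logDet c) (c.transDomain c') :=
    (g.contDiffOn_logDet c).mono fun q hq ↦ (AdaptedChart.mem_transDomain.1 hq).1
  -- Smooth as the difference of the two potentials.
  have hj : ContDiffOn ℝ ∞ (fun q ↦ (Real.log (Complex.normSq (c.jac c' q).det) : ℂ))
      (c.transDomain c') := (hs'.sub hs).congr fun q hq ↦ by
    rw [g.logDet_eq_add hq, add_sub_cancel_right]
  have h1 : EqOn (wirtBar w (g.logDet c)) (fun q ↦
      wirtBar w (fun q ↦ (Real.log (Complex.normSq (c.jac c' q).det) : ℂ)) q +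
        wirtBar w (fun q ↦ g.logDet c' (c.trans c' q)) q) (c.transDomain c') := fun q hq ↦ by
    simp only [wirtBar_eq_crDeriv]
    rw [crDeriv_congr_of_eqOn hU (fun q hq ↦ g.logDet_eq_add hq) hq,
      crDeriv_add (differentiableAt_of_contDiffOn hU hj hq)
        (differentiableAt_of_contDiffOn hU hs hq)]
  have h2 := ddbar_log_normSq (v := v) (w := w) hU contDiffOn_det_jac
    (fun q hq ↦ g.det_jac_ne_zero hq) hp
  have h3 := ddbar_comp_holomorphic (v := v) (w := w) hU c'.e.open_target
    AdaptedChart.contDiffOn_trans AdaptedChart.mapsTo_trans (g.contDiffOn_logDet c') hp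
  rw [ddbar, wirt_eq_crDeriv, crDeriv_congr_of_eqOn hU h1 hp, crDeriv_add
      (differentiableAt_of_contDiffOn hU (contDiffOn_wirtBar hU hj) hp)
      (differentiableAt_of_contDiffOn hU (contDiffOn_wirtBar hU hs) hp), ← wirt_eq_crDeriv]
  change ddbar _ p v w + ddbar _ p v w = _
  rw [h2, h3, zero_add]

/-- The form `ω_X` can be computed in any chart. -/
theorem omega_eq (c : AdaptedChart F) (hx : x ∈ c.e.source) (u w : Tan n x) :
    g.omega x u w = ddbar (g.logDet c) (c.e x) (c.comp x u) (c.comp x w) := by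
  have h0 : x ∈ (adaptedChartAt F x).e.source := (exists_adaptedChart F x).choose_spec
  rw [omega, g.ddbar_logDet_trans (AdaptedChart.mem_transDomain_of_mem_source h0 hx),
    ← AdaptedChart.comp_eq_fderiv_trans h0 hx, ← AdaptedChart.comp_eq_fderiv_trans h0 hx,
    AdaptedChart.trans, (adaptedChartAt F x).e.left_inv h0]

end RelativeMetric
end Charts

/-! ### The Kähler–Einstein algebra of a chart, the horizontal lift and the elliptic equation. -/

section Local

open scoped ComplexOrder

theorem crDeriv_exp {n : ℕ} {σ : ℂ} {v p : Model n} {G : Model n → ℂ}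
    (hG : DifferentiableAt ℝ G p) :
    crDeriv σ v (fun q ↦ Complex.exp (G q)) p = Complex.exp (G p) * crDeriv σ v G p := by
  have h1 := hG.hasFDerivAt.cexp
  rw [crDeriv_eq h1.differentiableAt, h1.fderiv, crDeriv_eq hG]
  simp only [smul_apply, smul_eq_mul]
  ring

theorem ddbar_eq_sum_left {n : ℕ} {U : Set (Model n)} {G : Model n → ℂ} {p : Model n}
    (hU : IsOpen U) (hG : ContDiffOn ℝ ∞ G U) (hp : p ∈ U) (v w : Model n) :
    ddbar G p v w = ∑ i, coord v i * ddbar G p (dir i) w :=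
  wirt_eq_sum (differentiableAt_of_contDiffOn hU (contDiffOn_wirtBar hU hG) hp) v

theorem contDiffOn_ddbar {n : ℕ} {U : Set (Model n)} {G : Model n → ℂ} (hU : IsOpen U)
    (hG : ContDiffOn ℝ ∞ G U) (v w : Model n) : ContDiffOn ℝ ∞ (fun p ↦ ddbar G p v w) U := by
  simp only [ddbar, wirt_eq_crDeriv]
  exact contDiffOn_crDeriv hU (contDiffOn_wirtBar hU hG)

variable {n : ℕ} {X : Type*} [TopologicalSpace X] [ChartedSpace (Model n) X]
  [IsManifold 𝓘(ℂ, Model n) ω X] {F : HolomorphicFamily n X}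

namespace RelativeMetric

variable (g : RelativeMetric F) (c : AdaptedChart F) {x : X} {p : Model n}

theorem inv_mul_coeff (hp : p ∈ c.e.target) :
    (Matrix.of fun β α ↦ g.inv c p β α) * g.coeff c p = 1 :=
  Matrix.nonsing_inv_mul _ (isUnit_iff_ne_zero.2 (g.det_coeff_pos c hp).ne')

theorem coeff_mul_inv (hp : p ∈ c.e.target) :
    g.coeff c p * (Matrix.of fun β α ↦ g.inv c p β α) = 1 :=
  Matrix.mul_nonsing_inv _ (isUnit_iff_ne_zero.2 (g.det_coeff_pos c hp).ne')

/-- The determinant is real and positive, so the real part taken in `logDet` loses nothing. -/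
theorem exp_logDet (hp : p ∈ c.e.target) : Complex.exp (g.logDet c p) = (g.coeff c p).det := by
  have h1 := Complex.lt_def.1 (g.det_coeff_pos c hp)
  rw [logDet, ← Complex.ofReal_exp, Real.exp_log h1.1]
  exact Complex.ext rfl h1.2

variable {U : Set (Model n)} (hU : IsOpen U) (hUc : U ⊆ c.e.target)

/-- The coefficients of the metric, as elements of the ring of smooth functions. -/
def coeffRing : Matrix (Fin n) (Fin n) (SmoothRing U) :=
  Matrix.of fun α β ↦ SmoothRing.of (fun p ↦ g.coeff c p α β) ((g.contDiffOn_coeff c α β).mono hUc)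

/-- The coefficients of the inverse metric, as elements of the ring of smooth functions. -/
def invRing : Matrix (Fin n) (Fin n) (SmoothRing U) :=
  Matrix.of fun β α ↦ SmoothRing.of (fun p ↦ g.inv c p β α) ((g.contDiffOn_inv c β α).mono hUc)

theorem invRing_mul_coeffRing : g.invRing c hUc * g.coeffRing c hUc = 1 := by
  ext1 α β
  refine SmoothRing.ext_eval fun p ↦ ?_
  have h1 := congrFun (congrFun (g.inv_mul_coeff c (hUc p.2)) α) β
  rw [Matrix.mul_apply] at h1
  rw [Matrix.mul_apply, map_sum]
  simp only [map_mul, invRing, coeffRing, Matrix.of_apply, SmoothRing.eval_of]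
  refine h1.trans ?_
  by_cases h : α = β <;> simp [Matrix.one_apply, h]

theorem coeffRing_mul_invRing : g.coeffRing c hUc * g.invRing c hUc = 1 :=
  mul_eq_one_comm.1 (g.invRing_mul_coeffRing c hUc)

theorem det_coeffRing : (g.coeffRing c hUc).det =
    SmoothRing.of (fun p ↦ Complex.exp (g.logDet c p)) ((g.contDiffOn_logDet c).mono hUc).cexp := by
  refine SmoothRing.ext_eval fun p ↦ ?_
  rw [RingHom.map_det, SmoothRing.eval_of, g.exp_logDet c (hUc p.2)]
  rfl

/-- Jacobi's formula divided by the determinant. Writing det = exp(log g) gives D det = det · D log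
g, and the exponential can be cancelled. -/
theorem der_logDet (σ : ℂ) (v : Model n) :
    SmoothRing.der hU σ v (SmoothRing.of (g.logDet c) ((g.contDiffOn_logDet c).mono hUc)) =
      (g.invRing c hUc * (g.coeffRing c hUc).map (SmoothRing.der hU σ v)).trace := by
  set D := SmoothRing.der hU σ v with hD
  have h1 := derivation_det D (g.coeffRing c hUc)
  have h2 : (g.coeffRing c hUc).adjugate = (g.coeffRing c hUc).det • g.invRing c hUc := by
    rw [← mul_one (g.coeffRing c hUc).adjugate, ← g.coeffRing_mul_invRing c hUc, ← mul_assoc,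
      Matrix.adjugate_mul, Matrix.smul_mul, one_mul]
  rw [h2, Matrix.smul_mul, Matrix.trace_smul, smul_eq_mul] at h1
  refine SmoothRing.ext_eval fun p ↦ ?_
  have h3 := congrArg (SmoothRing.eval p) h1
  rw [map_mul, g.det_coeffRing c hUc, hD, SmoothRing.eval_der_of, SmoothRing.eval_of,
    crDeriv_exp (differentiableAt_of_contDiffOn hU ((g.contDiffOn_logDet c).mono hUc) p.2)] at h3
  rw [hD, SmoothRing.eval_der_of]
  exact mul_left_cancel₀ (Complex.exp_ne_zero _) h3

variable {g} in
/-- The smooth functions in a chart, with the potential `log g`. -/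
def keAlgebra (hg : g.IsKahlerEinstein) : KEAlgebra (SmoothRing U) (Fin n) where
  D i := SmoothRing.der hU (-Complex.I) (dir i)
  Db i := SmoothRing.der hU Complex.I (dir i)
  comm_D _ _ _ := SmoothRing.der_comm _ _ _ _ _ _
  comm_Db _ _ _ := SmoothRing.der_comm _ _ _ _ _ _
  comm _ _ _ := SmoothRing.der_comm _ _ _ _ _ _
  G := SmoothRing.of (g.logDet c) ((g.contDiffOn_logDet c).mono hUc)
  h := g.coeffRing c hUc
  K := g.invRing c hUc
  h_eq α β := by
    rw [SmoothRing.der_of]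
    refine SmoothRing.ext_eval fun p ↦ ?_
    rw [SmoothRing.eval_der_of, ← wirtBar_eq_crDeriv, ← wirt_eq_crDeriv]
    exact hg c p (hUc p.2) α β
  K_mul := g.invRing_mul_coeffRing c hUc
  mul_K := g.coeffRing_mul_invRing c hUc
  ke i := g.der_logDet c hU hUc _ _

/-- The smooth functions on the image of a chart. -/
abbrev chartAlgebra (hg : g.IsKahlerEinstein) : KEAlgebra (SmoothRing c.e.target) (Fin n) :=
  keAlgebra c c.e.open_target subset_rfl hg

/-! ### The horizontal lift -/

/-- The components of the horizontal lift of `∂/∂s`. -/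
def horiz (p : Model n) : Model n :=
  (fun α ↦ -∑ ε, ddbar (g.logDet c) p (dir none) (dirZ ε) * g.inv c p ε α, 1)

variable {g} (hg : g.IsKahlerEinstein)

/-- By the Kähler–Einstein equation the vertical block of ω_X is the metric itself, hence
invertible. Orthogonality is then a uniquely solvable linear system for the vertical components of
V. -/
theorem orth_iff_eq_horiz (hg : g.IsKahlerEinstein) (hp : p ∈ c.e.target) (V : Model n) :
    (V.2 = 1 ∧ ∀ ε, ddbar (g.logDet c) p V (dirZ ε) = 0) ↔ V = g.horiz c p := by
  have h1 : V.2 = 1 → ∀ ε, ddbar (g.logDet c) p V (dirZ ε) =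
      ddbar (g.logDet c) p (dir none) (dirZ ε) + (V.1 ᵥ* g.coeff c p) ε := by
    intro hV ε
    rw [ddbar_eq_sum_left c.e.open_target (g.contDiffOn_logDet c) hp, Fintype.sum_option]
    simp only [coord, hV, one_mul, Matrix.vecMul, dotProduct, dir, hg c p hp]
  constructor
  · rintro ⟨hV, h2⟩
    refine Prod.ext (funext fun α ↦ ?_) hV
    have h3 : V.1 = (V.1 ᵥ* g.coeff c p) ᵥ* (Matrix.of fun β α ↦ g.inv c p β α) := by
      rw [Matrix.vecMul_vecMul, g.coeff_mul_inv c hp, Matrix.vecMul_one]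
    rw [h3]
    simp only [Matrix.vecMul, dotProduct, Matrix.of_apply, horiz, ← Finset.sum_neg_distrib,
      ← neg_mul]
    refine Finset.sum_congr rfl fun ε _ ↦ ?_
    congr 1
    have h4 := h1 hV ε
    rw [h2] at h4
    exact eq_neg_of_add_eq_zero_right h4.symm
  · rintro rfl
    refine ⟨rfl, fun ε ↦ ?_⟩
    rw [h1 rfl]
    have h3 : (g.horiz c p).1 = -((fun ε ↦ ddbar (g.logDet c) p (dir none) (dirZ ε)) ᵥ*
        (Matrix.of fun β α ↦ g.inv c p β α)) := by
      ext α
      simp [horiz, Matrix.vecMul, dotProduct]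
    rw [h3, Matrix.neg_vecMul, Matrix.vecMul_vecMul, g.inv_mul_coeff c hp, Matrix.vecMul_one]
    simp

theorem isHorizontalLift_iff (hg : g.IsKahlerEinstein) (hx : x ∈ c.e.source) (v : Tan n x) :
    g.IsHorizontalLift x v ↔ c.comp x v = g.horiz c (c.e x) := by
  rw [← orth_iff_eq_horiz c hg (c.e.map_source hx), c.comp_snd hx, IsHorizontalLift]
  refine and_congr_right fun _ ↦ ⟨fun h ε ↦ ?_, fun h w hw ↦ ?_⟩
  · rw [← c.comp_frame hx, ← g.omega_eq c hx]
    exact h _ (c.frame x ε).2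
  · rw [g.omega_eq c hx, ddbar_eq_sum c.e.open_target (g.contDiffOn_logDet c) (c.e.map_source hx),
      Finset.sum_comm, Fintype.sum_option]
    simp only [← Finset.sum_mul]
    simp only [← ddbar_eq_sum_left c.e.open_target (g.contDiffOn_logDet c) (c.e.map_source hx)]
    rw [show coord (c.comp x w) none = 0 from (c.mem_vert_iff hx w).1 hw]
    simp [dir, h]

theorem existsUnique_horizontalLift (hg : g.IsKahlerEinstein) (x : X) :
    ∃! v : Tan n x, g.IsHorizontalLift x v := by
  obtain ⟨c, hx⟩ := exists_adaptedChart F x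
  simp only [isHorizontalLift_iff c hg hx]
  exact (c.comp_bijective hx).existsUnique _

theorem contDiffOn_horiz (g : RelativeMetric F) (c : AdaptedChart F) (i : Option (Fin n)) :
    ContDiffOn ℝ ∞ (fun p ↦ coord (g.horiz c p) i) c.e.target := by
  cases i with
  | none => exact contDiffOn_const
  | some α =>
    exact (ContDiffOn.sum fun ε _ ↦ (contDiffOn_ddbar c.e.open_target (g.contDiffOn_logDet c) _
      _).mul (g.contDiffOn_inv c ε α)).neg

variable {v : ∀ x : X, Tan n x}

theorem comp_eq_horiz (hg : g.IsKahlerEinstein) (hv : ∀ x, g.IsHorizontalLift x (v x))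
    (hp : p ∈ c.e.target) : c.comp (c.e.symm p) (v (c.e.symm p)) = g.horiz c p := by
  rw [(isHorizontalLift_iff c hg (c.e.map_target hp) _).1 (hv _), c.e.right_inv hp]

theorem vecCoeff_eqOn (hg : g.IsKahlerEinstein) (hv : ∀ x, g.IsHorizontalLift x (v x))
    (α : Fin n) : EqOn (vecCoeff c v α) (fun p ↦ coord (g.horiz c p) (some α)) c.e.target :=
  fun p hp ↦ by rw [vecCoeff, comp_eq_horiz c hg hv hp]; rfl

theorem contDiffOn_vecCoeff (hg : g.IsKahlerEinstein) (hv : ∀ x, g.IsHorizontalLift x (v x))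
    (α : Fin n) : ContDiffOn ℝ ∞ (vecCoeff c v α) c.e.target :=
  (contDiffOn_horiz g c (some α)).congr (vecCoeff_eqOn c hg hv α)

theorem omega_self_eqOn (hg : g.IsKahlerEinstein) (hv : ∀ x, g.IsHorizontalLift x (v x))
    {φ : X → ℂ} (hφ : ∀ x, φ x = g.omega x (v x) (v x)) :
    EqOn (φ ∘ c.e.symm) (fun p ↦ ∑ i, ∑ j, coord (g.horiz c p) i *
      ddbar (g.logDet c) p (dir i) (dir j) * conj (coord (g.horiz c p) j)) c.e.target := by
  intro p hp
  simp only [Function.comp_apply]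
  rw [hφ, g.omega_eq c (c.e.map_target hp), comp_eq_horiz c hg hv hp, c.e.right_inv hp,
    ddbar_eq_sum c.e.open_target (g.contDiffOn_logDet c) hp]

theorem contDiffOn_omega_self (hg : g.IsKahlerEinstein) (hv : ∀ x, g.IsHorizontalLift x (v x))
    {φ : X → ℂ} (hφ : ∀ x, φ x = g.omega x (v x) (v x)) :
    ContDiffOn ℝ ∞ (φ ∘ c.e.symm) c.e.target :=
  (ContDiffOn.sum fun i _ ↦ ContDiffOn.sum fun j _ ↦ ((contDiffOn_horiz g c i).mul
    (contDiffOn_ddbar c.e.open_target (g.contDiffOn_logDet c) _ _)).mul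
      (contDiffOn_conj (contDiffOn_horiz g c j))).congr (omega_self_eqOn c hg hv hφ)

theorem omega_self_im (g : RelativeMetric F) (x : X) (u : Tan n x) : (g.omega x u u).im = 0 := by
  obtain ⟨c, hx⟩ := exists_adaptedChart F x
  rw [← Complex.conj_eq_iff_im, g.omega_eq c hx, conj_ddbar c.e.open_target (g.contDiffOn_logDet c)
    (c.e.map_source hx) fun q _ ↦ g.conj_logDet c q]

/-- The components of the horizontal lift in the ring of smooth functions. -/
def horizRing (g : RelativeMetric F) (c : AdaptedChart F) (i : Option (Fin n)) :
    SmoothRing c.e.target := SmoothRing.of (fun p ↦ coord (g.horiz c p) i) (contDiffOn_horiz g c i)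

/-- The complex conjugates of the components of the horizontal lift. -/
def horizRingConj (g : RelativeMetric F) (c : AdaptedChart F) (i : Option (Fin n)) :
    SmoothRing c.e.target := SmoothRing.of (fun p ↦ conj (coord (g.horiz c p) i))
      (contDiffOn_conj (contDiffOn_horiz g c i))

theorem eval_hess (hg : g.IsKahlerEinstein) (i j : Option (Fin n)) (p : c.e.target) :
    SmoothRing.eval p ((g.chartAlgebra c hg).D i
      ((g.chartAlgebra c hg).Db j
        (g.chartAlgebra c hg).G)) =
      ddbar (g.logDet c) p (dir i) (dir j) := by
  simp only [chartAlgebra, keAlgebra, SmoothRing.der_of]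
  rw [SmoothRing.eval_of, ← wirtBar_eq_crDeriv, ← wirt_eq_crDeriv]
  rfl

theorem orth_horiz (hg : g.IsKahlerEinstein) (hp : p ∈ c.e.target) (ε : Fin n) :
    ∑ i, coord (g.horiz c p) i * ddbar (g.logDet c) p (dir i) (dir (some ε)) = 0 := by
  rw [← ddbar_eq_sum_left c.e.open_target (g.contDiffOn_logDet c) hp]
  exact ((orth_iff_eq_horiz c hg hp _).2 rfl).2 ε

theorem isHorizontal_horizRing (hg : g.IsKahlerEinstein) :
    (g.chartAlgebra c hg).IsHorizontal (g.horizRing c) where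
  none := rfl
  orth ε := SmoothRing.ext_eval fun p ↦ by
    rw [map_sum, map_zero]
    simp only [map_mul, eval_hess, horizRing, SmoothRing.eval_of]
    exact orth_horiz c hg p.2 ε

/-- The elliptic equation, for the components of the horizontal lift. -/
theorem elliptic (hg : g.IsKahlerEinstein) (hv : ∀ x, g.IsHorizontalLift x (v x))
    {φ : X → ℂ} (hφ : ∀ x, φ x = g.omega x (v x) (v x)) {A : VForm F}
    (hp : p ∈ c.e.target) (hA : ∀ α β, A.coeff c α β p = wirtBar (dirZ β) (vecCoeff c v α) p) :
    g.laplacian c φ p + φ (c.e.symm p) = g.normSq c A p := by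
  have h1 := (isHorizontal_horizRing c hg).trace_ddbar (W := g.horizRingConj c)
    (SmoothRing.ext_eval fun q ↦ by simp [horizRingConj, SmoothRing.eval_of, coord, horiz])
    -- Since log g is real, its complex Hessian is hermitian, so conjugating the orthogonality of V
    -- gives that of its conjugate.
    (fun ε ↦ SmoothRing.ext_eval fun q ↦ by
      have h2 := congrArg conj (orth_horiz c hg q.2 ε)
      rw [map_sum, map_zero] at h2
      rw [map_sum, map_zero, ← h2]
      simp only [map_mul, eval_hess, horizRingConj, SmoothRing.eval_of]
      refine Finset.sum_congr rfl fun i _ ↦ ?_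
      rw [conj_ddbar c.e.open_target (g.contDiffOn_logDet c) q.2 fun q _ ↦ g.conj_logDet c q,
        mul_comm])
  have h2 : ∑ i, ∑ j, g.horizRing c i * (g.chartAlgebra c hg).D i ((g.chartAlgebra c hg).Db j
      (g.chartAlgebra c hg).G) * g.horizRingConj c j =
        SmoothRing.of (φ ∘ c.e.symm) (contDiffOn_omega_self c hg hv hφ) := by
    refine SmoothRing.ext_eval fun q ↦ ?_
    rw [SmoothRing.eval_of, omega_self_eqOn c hg hv hφ q.2]
    simp only [map_sum, map_mul, eval_hess]
    rfl
  rw [h2] at h1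
  have h3 := congrArg (SmoothRing.eval (⟨p, hp⟩ : c.e.target)) h1
  simp only [map_sum, map_sub, map_mul, SmoothRing.eval_of, keAlgebra, chartAlgebra, invRing, coeffRing,
    Matrix.of_apply, horizRing, horizRingConj] at h3
  simp only [SmoothRing.der_of, SmoothRing.eval_of, ← wirtBar_eq_crDeriv, ← wirt_eq_crDeriv] at h3
  have h4 : ∀ α β, wirtBar (dir (some β)) (fun q ↦ coord (g.horiz c q) (some α)) p =
      A.coeff c α β p := fun α β ↦ by
    rw [hA, wirtBar_eq_crDeriv]
    exact (crDeriv_congr_of_eqOn c.e.open_target (vecCoeff_eqOn c hg hv α) hp).symm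
  have h5 : ∀ α β, wirt (dir (some β)) (fun q ↦ conj (coord (g.horiz c q) (some α))) p =
      conj (A.coeff c α β p) := fun α β ↦ by
    rw [wirt_conj (differentiableAt_of_contDiffOn c.e.open_target (contDiffOn_horiz g c _) hp), h4]
  simp only [h4, h5] at h3
  simp only [dir] at h3
  rw [laplacian, Finset.sum_comm]
  have h6 : g.normSq c A p = ∑ β, ∑ α, ∑ γ, ∑ δ, g.inv c p β α * (A.coeff c γ β p *
      g.coeff c p γ δ * conj (A.coeff c δ α p)) := by
    rw [normSq, sum_sum_comm]
    refine Finset.sum_congr rfl fun β _ ↦ Finset.sum_congr rfl fun α _ ↦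
      Finset.sum_congr rfl fun γ _ ↦ Finset.sum_congr rfl fun δ _ ↦ ?_
    ring
  rw [h6]
  simp only [ddbar]
  have h7 : (φ ∘ c.e.symm) p = φ (c.e.symm p) := rfl
  rw [h7] at h3
  -- `h3` reads trace = φ - ‖A‖²; the Laplacian is minus the trace.
  linear_combination -h3

end RelativeMetric
end Local

/-! ### The form ∂̄v: independence of the chart, the Kodaira–Spencer class, coclosedness. -/

section Dbar

variable {n : ℕ} {X : Type*} [TopologicalSpace X] [ChartedSpace (Model n) X]
  [IsManifold 𝓘(ℂ, Model n) ω X] {F : HolomorphicFamily n X}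

/-- The `(0,1)`-form `∂̄ v` along the fibres, for a lift `v` of `∂/∂s`. -/
def dbarForm (v : ∀ x : X, Tan n x) : VForm F := fun x ↦
  { toFun w := ∑ α, (∑ β, conj (((adaptedChartAt F x).comp x (w : Tan n x)).1 β) *
      wirtBar (dirZ β) (vecCoeff (adaptedChartAt F x) v α) ((adaptedChartAt F x).e x)) •
        (adaptedChartAt F x).frame x α
    map_add' w w' := by
      simp only [Submodule.coe_add, map_add, Prod.fst_add, Pi.add_apply, add_mul,
        Finset.sum_add_distrib, add_smul]
    map_smul' a w := by
      simp only [Submodule.coe_smul, map_smul, Prod.smul_fst, Pi.smul_apply, smul_eq_mul, map_mul,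
        mul_assoc, ← Finset.mul_sum, mul_smul, Finset.smul_sum] }

namespace RelativeMetric

variable {g : RelativeMetric F} (c : AdaptedChart F) {p : Model n} {v : ∀ x : X, Tan n x}

/-- Both sides are the components of the same vector, the unique horizontal lift, so no formula for
the lift has to be transformed. -/
theorem horiz_trans {c c' : AdaptedChart F} (hg : g.IsKahlerEinstein) (hp : p ∈ c.transDomain c') :
    g.horiz c' (c.trans c' p) = fderiv ℂ (c.trans c') p (g.horiz c p) := by
  obtain ⟨h1, h2⟩ := AdaptedChart.mem_transDomain.1 hp
  obtain ⟨u, hu, -⟩ := existsUnique_horizontalLift hg (c.e.symm p)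
  have h3 := (isHorizontalLift_iff c hg (c.e.map_target h1) u).1 hu
  have h4 := (isHorizontalLift_iff c' hg h2 u).1 hu
  rw [c.e.right_inv h1] at h3
  rw [← h3]
  refine h4.symm.trans ?_
  rw [AdaptedChart.comp_eq_fderiv_trans (c.e.map_target h1) h2, c.e.right_inv h1]

/-- `dbarForm` uses one chosen chart per point, so its coefficients must be compared with those of
an arbitrary chart. The components of v change by a holomorphic Jacobian, through which ∂̄ passes,
and the s-component is the constant 1, so it contributes nothing. -/
theorem coeff_dbarForm (hg : g.IsKahlerEinstein) (hv : ∀ x, g.IsHorizontalLift x (v x))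
    (hp : p ∈ c.e.target) (α β : Fin n) :
    (dbarForm v : VForm F).coeff c α β p = wirtBar (dirZ β) (vecCoeff c v α) p := by
  set x := c.e.symm p with hxdef
  set c₀ := adaptedChartAt F x with hc₀
  have hx : x ∈ c.e.source := c.e.map_target hp
  have hx₀ : x ∈ c₀.e.source := (exists_adaptedChart F x).choose_spec
  have hp₀ := AdaptedChart.mem_transDomain_of_mem_source hx₀ hx
  set p₀ := c₀.e x
  have hΦ : c₀.trans c p₀ = p := by
    change c.e (c₀.e.symm (c₀.e x)) = p
    rw [c₀.e.left_inv hx₀]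
    exact c.e.right_inv hp
  set u := c₀.comp x (c.partialZ β p : Tan n x) with hu
  have hu2 : u.2 = 0 := (c₀.mem_vert_iff hx₀ _).1 (c.partialZ β p).2
  have hu' : fderiv ℂ (c₀.trans c) p₀ u = dirZ β := by
    rw [hu, ← AdaptedChart.comp_eq_fderiv_trans hx₀ hx, c.partialZ_eq_frame hp, c.comp_frame hx]
  have hsm : ∀ γ, DifferentiableAt ℝ (vecCoeff c₀ v γ) p₀ := fun γ ↦
    differentiableAt_of_contDiffOn c₀.e.open_target (contDiffOn_vecCoeff c₀ hg hv γ)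
      (c₀.e.map_source hx₀)
  have h1 : (dbarForm v : VForm F).coeff c α β p =
      ∑ γ, wirtBar u (vecCoeff c₀ v γ) p₀ * (fderiv ℂ (c₀.trans c) p₀ (dirZ γ)).1 α := by
    have e1 : ∀ γ, wirtBar u (vecCoeff c₀ v γ) p₀ =
        ∑ β, conj (u.1 β) * wirtBar (dirZ β) (vecCoeff c₀ v γ) p₀ := fun γ ↦ by
      rw [wirtBar_eq_sum (hsm γ), Fintype.sum_option]
      simp [coord, dir, hu2]
    rw [VForm.coeff, AdaptedChart.comp_eq_fderiv_trans hx₀ hx]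
    simp only [dbarForm, LinearMap.coe_mk, AddHom.coe_mk, Submodule.coe_sum, Submodule.coe_smul,
      map_sum, map_smul]
    rw [Prod.fst_sum, Finset.sum_apply]
    refine Finset.sum_congr rfl fun γ _ ↦ ?_
    rw [e1]
    change ((∑ β', conj (u.1 β') * wirtBar (dirZ β') (vecCoeff c₀ v γ) p₀) •
      fderiv ℂ (c₀.trans c) p₀ (c₀.comp x (c₀.frame x γ : Tan n x))).1 α = _
    rw [c₀.comp_frame hx₀]
    rfl
  have hU := (c₀.transDomain c).isOpen
  have h2 : EqOn (fun q ↦ vecCoeff c v α (c₀.trans c q)) (fun q ↦ ∑ i, coord (g.horiz c₀ q) i *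
      (fderiv ℂ (c₀.trans c) q (dir i)).1 α) (c₀.transDomain c) := fun q hq ↦ by
    refine (vecCoeff_eqOn c hg hv α (AdaptedChart.mapsTo_trans hq)).trans ?_
    simp only
    rw [horiz_trans hg hq]
    conv_lhs => rw [← sum_coord_smul_dir (g.horiz c₀ q)]
    simp [coord, Prod.fst_sum, Finset.sum_apply]
  have hJ : ∀ i, DifferentiableAt ℂ (fun q ↦ (fderiv ℂ (c₀.trans c) q (dir i)).1 α) p₀ := fun i ↦
    ((contDiffOn_pi.1 (AdaptedChart.contDiffOn_fderiv_trans (dir i)).fst α).contDiffAt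
      (hU.mem_nhds hp₀)).differentiableAt (by simp)
  have hV : ∀ i, DifferentiableAt ℝ (fun q ↦ coord (g.horiz c₀ q) i) p₀ := fun i ↦
    differentiableAt_of_contDiffOn c₀.e.open_target (contDiffOn_horiz g c₀ i)
      (c₀.e.map_source hx₀)
  have h3 : wirtBar (dirZ β) (vecCoeff c v α) p =
      ∑ γ, wirtBar u (vecCoeff c₀ v γ) p₀ * (fderiv ℂ (c₀.trans c) p₀ (dirZ γ)).1 α := by
    have e1 : DifferentiableAt ℝ (vecCoeff c v α) (c₀.trans c p₀) := by
      rw [hΦ]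
      exact differentiableAt_of_contDiffOn c.e.open_target (contDiffOn_vecCoeff c hg hv α) hp
    have e2 := crDeriv_comp_holomorphic (σ := Complex.I) (v := u)
      (AdaptedChart.differentiableAt_trans hp₀) e1
    rw [hu', hΦ] at e2
    rw [wirtBar_eq_crDeriv, ← e2, crDeriv_congr_of_eqOn hU h2 hp₀,
      crDeriv_sum _ fun i _ ↦ (hV i).fun_mul ((hJ i).restrictScalars ℝ), Fintype.sum_option]
    have e3 : ∀ i, crDeriv Complex.I u (fun q ↦ coord (g.horiz c₀ q) i *
        (fderiv ℂ (c₀.trans c) q (dir i)).1 α) p₀ =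
        wirtBar u (fun q ↦ coord (g.horiz c₀ q) i) p₀ *
          (fderiv ℂ (c₀.trans c) p₀ (dir i)).1 α := fun i ↦ by
      rw [crDeriv_mul (hV i) ((hJ i).restrictScalars ℝ), ← wirtBar_eq_crDeriv,
        wirtBar_of_holomorphic (hJ i), mul_zero, zero_add, mul_comm]
    have e4 : wirtBar u (fun q ↦ coord (g.horiz c₀ q) none) p₀ = 0 := by
      rw [wirtBar_eq_crDeriv]
      exact crDeriv_const 1
    rw [e3, e4, zero_mul, zero_add]
    refine Finset.sum_congr rfl fun γ _ ↦ ?_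
    rw [e3, wirtBar_eq_crDeriv, ← crDeriv_congr_of_eqOn c₀.e.open_target
      (vecCoeff_eqOn c₀ hg hv γ) (c₀.e.map_source hx₀)]
    rfl
  rw [h1, h3]

theorem coeff_dbarForm_eqOn (hg : g.IsKahlerEinstein) (hv : ∀ x, g.IsHorizontalLift x (v x))
    (α β : Fin n) :
    EqOn ((dbarForm v : VForm F).coeff c α β) (wirtBar (dirZ β) (vecCoeff c v α)) c.e.target :=
  fun _ hp ↦ coeff_dbarForm c hg hv hp α β

theorem contDiffOn_coeff_dbarForm (hg : g.IsKahlerEinstein)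
    (hv : ∀ x, g.IsHorizontalLift x (v x)) (α β : Fin n) :
    ContDiffOn ℝ ∞ ((dbarForm v : VForm F).coeff c α β) c.e.target :=
  (contDiffOn_wirtBar c.e.open_target (contDiffOn_vecCoeff c hg hv α)).congr
    (coeff_dbarForm_eqOn c hg hv α β)

theorem _root_.KEFamily.smoothOnFibre_of_contDiffOn {G : Model n → ℂ}
    (hG : ContDiffOn ℝ ∞ G c.e.target) (s : ℂ) : SmoothOnFibre c s G :=
  hG.comp (contDiff_id.prodMk contDiff_const).contDiffOn fun _ hz ↦ hz

theorem isDbarClosed_dbarForm (hg : g.IsKahlerEinstein) (hv : ∀ x, g.IsHorizontalLift x (v x))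
    (s : ℂ) : (dbarForm v : VForm F).IsDbarClosed s := by
  intro c p hp _ α β γ
  rw [wirtBar_eq_crDeriv, wirtBar_eq_crDeriv,
    crDeriv_congr_of_eqOn c.e.open_target (coeff_dbarForm_eqOn c hg hv α β) hp,
    crDeriv_congr_of_eqOn c.e.open_target (coeff_dbarForm_eqOn c hg hv α γ) hp,
    wirtBar_eq_crDeriv, wirtBar_eq_crDeriv,
    crDeriv_comm c.e.open_target (contDiffOn_vecCoeff c hg hv α) hp]

theorem isDbar_dbarForm (hg : g.IsKahlerEinstein) (hv : ∀ x, g.IsHorizontalLift x (v x))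
    (s : ℂ) : IsDbar s v (dbarForm v : VForm F) :=
  fun c _ hp _ α β ↦ coeff_dbarForm c hg hv hp α β

theorem cohomologous_self (A : VForm F) (s : ℂ) : Cohomologous s A A := by
  have h1 : ∀ (c : AdaptedChart F) α, vecCoeff c (fun x ↦ (0 : Tan n x)) α = fun _ ↦ 0 := by
    intro c α
    ext p
    simp [vecCoeff]
  refine ⟨fun _ ↦ 0, fun _ ↦ 0, ⟨fun x _ ↦ map_zero _, fun c α ↦ ?_⟩, fun c p hp _ α β ↦ ?_,
    fun x _ ↦ sub_self _⟩
  · rw [h1]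
    exact contDiffOn_const
  · rw [h1, wirtBar_eq_crDeriv, crDeriv_const]
    simp [VForm.coeff]

theorem representsKodairaSpencer_dbarForm (hg : g.IsKahlerEinstein)
    (hv : ∀ x, g.IsHorizontalLift x (v x)) (s : ℂ) :
    (dbarForm v : VForm F).RepresentsKodairaSpencer s :=
  ⟨fun c α β ↦ smoothOnFibre_of_contDiffOn c (contDiffOn_coeff_dbarForm c hg hv α β) s,
    isDbarClosed_dbarForm hg hv s, v, dbarForm v,
    ⟨fun x _ ↦ (hv x).1, fun c α ↦ smoothOnFibre_of_contDiffOn c (contDiffOn_vecCoeff c hg hv α) s⟩,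
    isDbar_dbarForm hg hv s, cohomologous_self _ s⟩

/-! ### Coclosedness -/

/-- A vertical derivative only sees values on the slice of constant s. Stated with line derivatives
it needs no differentiability, so it applies to data smooth on a single fibre. -/
theorem _root_.KEFamily.crDeriv_congr_slice {σ : ℂ} {U : Set (Model n)} (hU : IsOpen U)
    {G H : Model n → ℂ} (hp : p ∈ U) (h : ∀ q ∈ U, q.2 = p.2 → G q = H q) {v : Model n}
    (hv : v.2 = 0) : crDeriv σ v G p = crDeriv σ v H p := by
  have key : ∀ w : Model n, w.2 = 0 → lineDeriv ℝ G p w = lineDeriv ℝ H p w := by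
    intro w hw
    refine Filter.EventuallyEq.deriv_eq ?_
    have h1 : ContinuousAt (fun t : ℝ ↦ p + t • w) 0 := by fun_prop
    filter_upwards [h1.eventually_mem (by simpa using hU.mem_nhds hp)] with t ht
    exact h _ ht (by simp [hw])
  rw [crDeriv, crDeriv, key v hv, key _ (by simp [hv])]

variable {U : Set (Model n)} (hU : IsOpen U) (hUc : U ⊆ c.e.target)

/-- Lowering the upper index turns covariant derivatives into plain ones
(`KEAlgebra.sum_h_covDeriv`), so the divergence can be computed in the ring. The functions `b` are
smooth extensions of the coefficients of B off the slice through p. -/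
theorem sum_coeff_covDeriv (hg : g.IsKahlerEinstein) (B : VForm F) (p : U)
    (b : Fin n → Fin n → Model n → ℂ) (hb : ∀ α β, ContDiffOn ℝ ∞ (b α β) U)
    (hB : ∀ α β, ∀ q ∈ U, q.2 = p.1.2 → b α β q = B.coeff c α β q) (ε : Fin n) :
    SmoothRing.eval p (∑ β, ∑ γ, (keAlgebra c hU hUc hg).K β γ *
      (keAlgebra c hU hUc hg).D (some γ) (∑ α, (keAlgebra c hU hUc hg).h α ε *
        SmoothRing.of (b α β) (hb α β))) =
    ∑ α, g.coeff c p α ε * ∑ β, ∑ γ, g.inv c p β γ * g.covDeriv B c p α β γ := by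
  have h1 : ∀ α β γ, wirt (dirZ γ) (b α β) p = wirt (dirZ γ) (B.coeff c α β) p := fun α β γ ↦ by
    rw [wirt_eq_crDeriv]
    exact crDeriv_congr_slice hU p.2 (hB α β) rfl
  have h2 : ∀ α β, b α β p = B.coeff c α β p := fun α β ↦ hB α β p p.2 rfl
  have h3 : ∀ α β γ, SmoothRing.eval p ((keAlgebra c hU hUc hg).D (some γ)
      (SmoothRing.of (b α β) (hb α β)) + ∑ δ, (∑ μ, (keAlgebra c hU hUc hg).K μ α *
        (keAlgebra c hU hUc hg).D (some γ) ((keAlgebra c hU hUc hg).h δ μ)) *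
          SmoothRing.of (b δ β) (hb δ β)) = g.covDeriv B c p α β γ := by
    intro α β γ
    simp only [keAlgebra, coeffRing, invRing, Matrix.of_apply, map_add, map_sum, map_mul,
      SmoothRing.der_of, SmoothRing.eval_of, ← wirt_eq_crDeriv]
    simp only [dir, h1, h2]
    rfl
  have h4 : ∀ Y : Fin n → Fin n → Fin n → SmoothRing U,
      SmoothRing.eval p (∑ β, ∑ γ, (keAlgebra c hU hUc hg).K β γ *
        ∑ α, (keAlgebra c hU hUc hg).h α ε * Y α β γ) =
      ∑ α, g.coeff c p α ε * ∑ β, ∑ γ, g.inv c p β γ * SmoothRing.eval p (Y α β γ) := by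
    intro Y
    simp only [map_sum, map_mul, Finset.mul_sum]
    conv_rhs => rw [Finset.sum_comm]
    refine Finset.sum_congr rfl fun β _ ↦ ?_
    conv_rhs => rw [Finset.sum_comm]
    exact Finset.sum_congr rfl fun γ _ ↦ Finset.sum_congr rfl fun α _ ↦ mul_left_comm _ _ _
  simp only [← KEAlgebra.sum_h_covDeriv]
  rw [h4]
  simp only [h3]

/-- With its index lowered ∂̄v is -E, whose divergence is V^i G_{iε̄} = 0 by `sum_sum_K_D_E` and
orthogonality. Inverting the metric raises the index again. -/
theorem isDbarCoclosed_dbarForm (hg : g.IsKahlerEinstein)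
    (hv : ∀ x, g.IsHorizontalLift x (v x)) (s : ℂ) : g.IsDbarCoclosed (dbarForm v) s := by
  intro c p hp _ α
  rw [neg_eq_zero]
  have h1 : ∀ ε, ∑ α, g.coeff c p α ε *
      ∑ β, ∑ γ, g.inv c p β γ * g.covDeriv (dbarForm v) c p α β γ = 0 := by
    intro ε
    rw [← sum_coeff_covDeriv c c.e.open_target subset_rfl hg (dbarForm v) ⟨p, hp⟩
      (fun α β ↦ (dbarForm v : VForm F).coeff c α β) (contDiffOn_coeff_dbarForm c hg hv)
      (fun _ _ _ _ _ ↦ rfl)]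
    have h2 : ∀ β, ∑ α, (g.chartAlgebra c hg).h α ε *
        SmoothRing.of ((dbarForm v : VForm F).coeff c α β)
          (contDiffOn_coeff_dbarForm c hg hv α β) =
        -(g.chartAlgebra c hg).E (g.horizRing c) (some β) (some ε) := by
      intro β
      rw [(isHorizontal_horizRing c hg).E_eq, neg_neg]
      refine Finset.sum_congr rfl fun α _ ↦ ?_
      rw [mul_comm]
      congr 1
      simp only [chartAlgebra, keAlgebra, horizRing, SmoothRing.der_of]
      refine SmoothRing.of_congr _ _ fun q hq ↦ ?_
      rw [coeff_dbarForm c hg hv hq, wirtBar_eq_crDeriv]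
      exact crDeriv_congr_of_eqOn c.e.open_target (vecCoeff_eqOn c hg hv α) hq
    simp only [h2, map_neg, mul_neg, Finset.sum_neg_distrib]
    rw [(isHorizontal_horizRing c hg).sum_sum_K_D_E, (isHorizontal_horizRing c hg).orth, map_zero,
      neg_zero]
  have h3 : (fun α ↦ ∑ β, ∑ γ, g.inv c p β γ * g.covDeriv (dbarForm v) c p α β γ) ᵥ*
      g.coeff c p = 0 := by
    ext ε
    rw [Matrix.vecMul, dotProduct, Pi.zero_apply, ← h1 ε]
    exact Finset.sum_congr rfl fun _ _ ↦ mul_comm _ _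
  have h4 := congrArg (· ᵥ* (Matrix.of fun β α ↦ g.inv c p β α)) h3
  simp only [Matrix.vecMul_vecMul, g.coeff_mul_inv c hp, Matrix.vecMul_one, Matrix.zero_vecMul]
    at h4
  exact congrFun h4 α

end RelativeMetric
end Dbar

/-! ### Complex conjugation on the ring of smooth functions. -/

namespace SmoothRing

variable {n : ℕ} {U : Set (Model n)}

/-- Complex conjugation of smooth functions. -/
def conjHom : SmoothRing U →+* SmoothRing U where
  toFun f := of (fun p ↦ conj (extendZero f.1 p)) (contDiffOn_conj f.2)
  map_one' := ext_eval fun p ↦ by rw [eval_of, extendZero_eq, map_one, map_one]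
  map_zero' := ext_eval fun p ↦ by rw [eval_of, extendZero_eq, map_zero, map_zero]
  map_add' f g := ext_eval fun p ↦ by
    rw [map_add, eval_of, eval_of, eval_of, extendZero_eq, extendZero_eq, extendZero_eq, map_add,
      map_add]
  map_mul' f g := ext_eval fun p ↦ by
    rw [map_mul, eval_of, eval_of, eval_of, extendZero_eq, extendZero_eq, extendZero_eq, map_mul,
      map_mul]

theorem eval_conjHom (f : SmoothRing U) (p : U) : eval p (conjHom f) = conj (eval p f) := by
  rw [← extendZero_eq f]
  rfl

theorem conjHom_of (F : Model n → ℂ) (hF : ContDiffOn ℝ ∞ F U) :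
    conjHom (of F hF) = of (fun p ↦ conj (F p)) (contDiffOn_conj hF) :=
  ext_eval fun p ↦ by rw [eval_conjHom, eval_of, eval_of]

theorem conjHom_der (hU : IsOpen U) (σ : ℂ) (v : Model n) (f : SmoothRing U) :
    conjHom (der hU σ v f) = der hU (conj σ) v (conjHom f) := by
  obtain ⟨F, hF, rfl⟩ := exists_of f
  rw [conjHom_of, der_of, der_of, conjHom_of]
  refine of_congr _ _ fun p hp ↦ ?_
  rw [crDeriv_conj (differentiableAt_of_contDiffOn hU hF hp), Complex.conj_conj]

end SmoothRing

/-! ### The Bochner formula at a maximum of the length of a vector field. -/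

section MaximumPrinciple

open scoped ComplexOrder

variable {n : ℕ} {X : Type*} [TopologicalSpace X] [ChartedSpace (Model n) X]
  [IsManifold 𝓘(ℂ, Model n) ω X] {F : HolomorphicFamily n X}

namespace RelativeMetric

variable {g : RelativeMetric F} (c : AdaptedChart F) {U : Set (Model n)} (hUc : U ⊆ c.e.target)

theorem conj_coeff (g : RelativeMetric F) (c : AdaptedChart F) (p : Model n) (α β : Fin n) :
    conj (g.coeff c p α β) = g.coeff c p β α := (g.hermitian _ _ _).symm

theorem posDef_inv (g : RelativeMetric F) (c : AdaptedChart F) {p : Model n}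
    (hp : p ∈ c.e.target) : (Matrix.of fun β α ↦ g.inv c p β α).PosDef :=
  (g.posDef_coeff c hp).inv

theorem conj_inv (g : RelativeMetric F) (c : AdaptedChart F) {p : Model n}
    (hp : p ∈ c.e.target) (α β : Fin n) : conj (g.inv c p α β) = g.inv c p β α :=
  (g.posDef_inv c hp).isHermitian.apply β α

theorem conjHom_coeffRing (α β : Fin n) :
    SmoothRing.conjHom (g.coeffRing c hUc α β) = g.coeffRing c hUc β α :=
  SmoothRing.ext_eval fun p ↦ by
    rw [SmoothRing.eval_conjHom]
    exact g.conj_coeff c p α β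

theorem conjHom_invRing (α β : Fin n) :
    SmoothRing.conjHom (g.invRing c hUc α β) = g.invRing c hUc β α :=
  SmoothRing.ext_eval fun p ↦ by
    rw [SmoothRing.eval_conjHom]
    exact g.conj_inv c (hUc p.2) α β

/-- The squared length of a vertical vector field with components `W`. -/
def lengthSq (g : RelativeMetric F) (c : AdaptedChart F) (W : Fin n → Model n → ℂ)
    (p : Model n) : ℂ :=
  ∑ α, ∑ ε, W α p * g.coeff c p α ε * conj (W ε p)

theorem conj_lengthSq (W : Fin n → Model n → ℂ) (p : Model n) :
    conj (g.lengthSq c W p) = g.lengthSq c W p := by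
  simp only [lengthSq, map_sum, map_mul, conj_coeff, Complex.conj_conj]
  rw [Finset.sum_comm]
  exact Finset.sum_congr rfl fun _ _ ↦ Finset.sum_congr rfl fun _ _ ↦ by ring

theorem contDiffOn_lengthSq (g : RelativeMetric F) (c : AdaptedChart F) (hUc : U ⊆ c.e.target)
    {W : Fin n → Model n → ℂ} (hW : ∀ α, ContDiffOn ℝ ∞ (W α) U) :
    ContDiffOn ℝ ∞ (g.lengthSq c W) U :=
  ContDiffOn.sum fun α _ ↦ ContDiffOn.sum fun ε _ ↦
    ((hW α).mul ((g.contDiffOn_coeff c α ε).mono hUc)).mul (contDiffOn_conj (hW ε))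

/-- At a maximum, the trace of the complex Hessian along the fibre is not positive. -/
theorem trace_hess_nonpos (g : RelativeMetric F) (c : AdaptedChart F) {p : Model n} (hU : IsOpen U)
    (hp : p ∈ U) (hpc : p ∈ c.e.target) {ψ : Model n → ℂ} (hψ : ContDiffOn ℝ ∞ ψ U)
    (hr : ∀ q ∈ U, conj (ψ q) = ψ q)
    (hmax : ∀ v : Model n, v.2 = 0 → IsLocalMax (fun t : ℝ ↦ (ψ (p + t • v)).re) 0) :
    ∑ β, ∑ γ, g.inv c p β γ * ddbar ψ p (dirZ γ) (dirZ β) ≤ 0 := by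
  let P : Matrix (Fin n) (Fin n) ℂ := Matrix.of fun γ β ↦ -ddbar ψ p (dirZ γ) (dirZ β)
  have hP : P.PosSemidef := by
    refine Matrix.PosSemidef.of_dotProduct_mulVec_nonneg ?_ fun x ↦ ?_
    · ext γ β
      simp only [P, Matrix.conjTranspose_apply, Matrix.of_apply, star_neg, Complex.star_def,
        conj_ddbar hU hψ hp hr]
    -- Conjugated because ∂∂̄ψ is linear in its first entry, and vertical so that `hmax` applies to
    -- v and iv.
    · let v : Model n := (fun γ ↦ conj (x γ), 0)
      have h1 : star x ⬝ᵥ P *ᵥ x = -ddbar ψ p v v := by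
        rw [ddbar_eq_sum hU hψ hp, Fintype.sum_option]
        simp only [Fintype.sum_option]
        simp only [P, v, coord, dir, map_zero, mul_zero, zero_mul, Finset.sum_const_zero, zero_add,
          add_zero, dotProduct, Matrix.mulVec, Matrix.of_apply, Finset.mul_sum,
          ← Finset.sum_neg_distrib, Complex.conj_conj]
        refine Finset.sum_congr rfl fun γ _ ↦ Finset.sum_congr rfl fun β _ ↦ ?_
        rw [Pi.star_apply, Complex.star_def]
        ring
      have h2 := ddbar_self_re_nonpos hU hψ hp v (hmax v rfl) (hmax _ (by simp [v]))
      have h3 := Complex.conj_eq_iff_im.1 (conj_ddbar hU hψ hp hr v v)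
      rw [h1, Complex.le_def]
      constructor
      · simpa using h2
      · simp [h3]
  have h1 := trace_mul_nonneg (g.posDef_inv c hpc).posSemidef hP
  simp only [P, Matrix.trace, Matrix.diag, Matrix.mul_apply, Matrix.of_apply, mul_neg,
    Finset.sum_neg_distrib] at h1
  exact neg_nonneg.1 h1

/-- The squared length of a vector field `W` with `∂̄^* ∂̄ W = 0` cannot have a positive maximum. -/
theorem lengthSq_nonpos (hU : IsOpen U) (hUc : U ⊆ c.e.target) (hg : g.IsKahlerEinstein) {W : Fin n → Model n → ℂ} (p : U)
    (hW : ∀ α, ContDiffOn ℝ ∞ (W α) U) (B : VForm F)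
    (hB : ∀ α β, ∀ q ∈ U, q.2 = p.1.2 → wirtBar (dirZ β) (W α) q = B.coeff c α β q)
    (hco : ∀ α, ∑ β, ∑ γ, g.inv c p β γ * g.covDeriv B c p α β γ = 0)
    (hmax : ∀ v : Model n, v.2 = 0 →
      IsLocalMax (fun t : ℝ ↦ (g.lengthSq c W (p + t • v)).re) 0) :
    g.lengthSq c W p ≤ 0 := by
  set A := keAlgebra c hU hUc hg with hA
  let w : Fin n → SmoothRing U := fun α ↦ SmoothRing.of (W α) (hW α)
  let wb : Fin n → SmoothRing U := fun α ↦ SmoothRing.conjHom (w α)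
  have hD : ∀ i f, SmoothRing.conjHom (A.D i f) = A.Db i (SmoothRing.conjHom f) := fun i f ↦ by
    simp only [hA, keAlgebra, SmoothRing.conjHom_der, map_neg, Complex.conj_I, neg_neg]
  have hDb : ∀ i f, SmoothRing.conjHom (A.Db i f) = A.D i (SmoothRing.conjHom f) := fun i f ↦ by
    simp only [hA, keAlgebra, SmoothRing.conjHom_der, Complex.conj_I]
  have hh : ∀ α β, SmoothRing.conjHom (A.h α β) = A.h β α := conjHom_coeffRing c hUc
  have hK : ∀ α β, SmoothRing.conjHom (A.K α β) = A.K β α := conjHom_invRing c hUc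
  have eK : ∀ α β, SmoothRing.eval p (A.K α β) = g.inv c p α β := fun _ _ ↦ rfl
  have eh : ∀ α β, SmoothRing.eval p (A.h α β) = g.coeff c p α β := fun _ _ ↦ rfl
  have h1 := congrArg (SmoothRing.eval p) (A.bochner w wb)
  have hΨ : ∑ α, ∑ ε, w α * A.h α ε * wb ε =
      SmoothRing.of (g.lengthSq c W) (g.contDiffOn_lengthSq c hUc hW) := by
    refine SmoothRing.ext_eval fun q ↦ ?_
    simp only [map_sum, map_mul, SmoothRing.eval_of, wb, SmoothRing.eval_conjHom, lengthSq]
    rfl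
  -- Coclosedness of ∂̄W removes the first Bochner term; `hQb` removes its conjugate.
  have hQ : ∀ ε, SmoothRing.eval p (∑ β, ∑ γ, A.K β γ *
      A.D (some γ) (∑ α, A.h α ε * A.Db (some β) (w α))) = 0 := by
    intro ε
    have h2 := sum_coeff_covDeriv c hU hUc hg B p (fun α β ↦ wirtBar (dirZ β) (W α))
      (fun α β ↦ contDiffOn_wirtBar hU (hW α)) hB ε
    simp only [hco, mul_zero, Finset.sum_const_zero] at h2
    rw [← h2]
    simp only [w, hA, keAlgebra, SmoothRing.der_of]
    rfl
  have hQb : ∀ α, SmoothRing.eval p (∑ β, ∑ γ, A.K β γ *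
      A.Db (some β) (∑ ε, A.h α ε * A.D (some γ) (wb ε))) = 0 := by
    intro α
    have h2 := congrArg conj (hQ α)
    rw [← SmoothRing.eval_conjHom, map_zero] at h2
    rw [← h2]
    congr 1
    simp only [map_sum, map_mul, hD, hDb, hh, hK, wb]
    rw [Finset.sum_comm]
  -- This exhibits the fourth Bochner term as the squared norm of ∂_γ(w^μ h_{με̄}) in two copies of
  -- the inverse metric.
  have hN : ∀ β α, A.Db (some β) (∑ μ, A.h α μ * wb μ) =
      SmoothRing.conjHom (A.D (some β) (∑ μ, w μ * A.h μ α)) := by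
    intro β α
    rw [hD]
    simp only [map_sum, map_mul, hh, wb]
    exact Finset.sum_congr rfl fun _ _ ↦ by rw [mul_comm]
  have h3 := sum_sum_form_nonneg' (g.posDef_inv c (hUc p.2)).posSemidef
    (g.posDef_coeff c (hUc p.2)).posSemidef
    (fun β α ↦ SmoothRing.eval p (A.Db (some β) (w α)))
  have h4 := sum_sum_form_nonneg (g.posDef_inv c (hUc p.2)).posSemidef
    (g.posDef_inv c (hUc p.2)).posSemidef
    (fun γ ε ↦ SmoothRing.eval p (A.D (some γ) (∑ μ, w μ * A.h μ ε)))
  have h5 := g.trace_hess_nonpos c hU p.2 (hUc p.2) (g.contDiffOn_lengthSq c hUc hW)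
    (fun q _ ↦ conj_lengthSq c W q) hmax
  have e1 : SmoothRing.eval p (∑ β, ∑ γ, A.K β γ * A.D (some γ) (A.Db (some β)
      (∑ α, ∑ ε, w α * A.h α ε * wb ε))) =
      ∑ β, ∑ γ, g.inv c p β γ * ddbar (g.lengthSq c W) p (dirZ γ) (dirZ β) := by
    rw [hΨ]
    simp only [map_sum, map_mul, eK]
    simp only [hA, keAlgebra, SmoothRing.der_of, SmoothRing.eval_of, ddbar, wirt_eq_crDeriv]
    rfl
  have e2 : SmoothRing.eval p (∑ β, ∑ γ, A.K β γ *
      ∑ α, ∑ ε, A.Db (some β) (w α) * A.h α ε * A.D (some γ) (wb ε)) =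
      ∑ β, ∑ γ, (Matrix.of fun β α ↦ g.inv c p β α) β γ * ∑ α, ∑ ε,
        SmoothRing.eval p (A.Db (some β) (w α)) * g.coeff c p α ε *
          conj (SmoothRing.eval p (A.Db (some γ) (w ε))) := by
    have e3 : ∀ γ ε, A.D (some γ) (wb ε) = SmoothRing.conjHom (A.Db (some γ) (w ε)) :=
      fun γ ε ↦ (hDb _ _).symm
    simp only [e3]
    simp only [map_sum, map_mul, SmoothRing.eval_conjHom, eK, eh, Matrix.of_apply]
  have e4 : SmoothRing.eval p (∑ β, ∑ γ, A.K β γ * ∑ ε, ∑ α,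
      A.D (some γ) (∑ μ, w μ * A.h μ ε) * A.K ε α * A.Db (some β) (∑ μ, A.h α μ * wb μ)) =
      ∑ β, ∑ γ, (Matrix.of fun β α ↦ g.inv c p β α) β γ * ∑ ε, ∑ α,
        SmoothRing.eval p (A.D (some γ) (∑ μ, w μ * A.h μ ε)) *
          (Matrix.of fun β α ↦ g.inv c p β α) ε α *
          conj (SmoothRing.eval p (A.D (some β) (∑ μ, w μ * A.h μ α))) := by
    have e5 : ∀ N : Fin n → Fin n → SmoothRing U, SmoothRing.eval p (∑ β, ∑ γ, A.K β γ *
        ∑ ε, ∑ α, N γ ε * A.K ε α * SmoothRing.conjHom (N β α)) =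
        ∑ β, ∑ γ, (Matrix.of fun β α ↦ g.inv c p β α) β γ * ∑ ε, ∑ α, SmoothRing.eval p (N γ ε) *
          (Matrix.of fun β α ↦ g.inv c p β α) ε α * conj (SmoothRing.eval p (N β α)) := fun N ↦ by
      simp only [map_sum, map_mul, SmoothRing.eval_conjHom, eK, Matrix.of_apply]
    simp only [hN]
    exact e5 fun γ ε ↦ A.D (some γ) (∑ μ, w μ * A.h μ ε)
  rw [e1] at h1
  rw [h1] at h5
  rw [map_add, map_add, map_add, map_add, e2, e4, map_sum, map_sum, hΨ, SmoothRing.eval_of] at h5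
  simp only [map_mul, hQ, hQb, zero_mul, Finset.sum_const_zero, zero_add] at h5
  -- What is left of `h5` is |∂̄W|² + |∇W|² + |W|² ≤ 0, and the first two terms are nonnegative by
  -- `h3` and `h4`.
  refine le_trans ?_ h5
  exact le_add_of_nonneg_left (add_nonneg h3 h4)

end RelativeMetric
end MaximumPrinciple

/-! ### Uniqueness of the harmonic representative, for data smooth on one fibre only. -/

section Uniqueness

open scoped ComplexOrder

variable {n : ℕ} {X : Type*} [TopologicalSpace X] [ChartedSpace (Model n) X]
  [IsManifold 𝓘(ℂ, Model n) ω X] {F : HolomorphicFamily n X}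

/-- The function that is constant in the direction of `s` and agrees with `G` over `s`. -/
def freeze (s : ℂ) (G : Model n → ℂ) (p : Model n) : ℂ := G (p.1, s)

/-- The points of the image of `c` whose projection to the fibre over `s` is in the image. -/
def sliceDomain (c : AdaptedChart F) (s : ℂ) : Set (Model n) :=
  {p | p ∈ c.e.target ∧ (p.1, s) ∈ c.e.target}

variable {c : AdaptedChart F} {s : ℂ} {p : Model n} {G H : Model n → ℂ}

theorem isOpen_sliceDomain : IsOpen (sliceDomain c s) :=
  c.e.open_target.inter
    (c.e.open_target.preimage ((continuous_fst.prodMk continuous_const : Continuous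
      fun p : Model n ↦ ((p.1, s) : Model n))))

theorem sliceDomain_subset : sliceDomain c s ⊆ c.e.target := fun _ hp ↦ hp.1

theorem mem_sliceDomain (hp : p ∈ c.e.target) (hs : p.2 = s) : p ∈ sliceDomain c s :=
  ⟨hp, by rwa [← hs]⟩

theorem freeze_apply (hs : p.2 = s) : freeze s G p = G p := by
  rw [freeze, ← hs]

theorem SmoothOnFibre.contDiffOn_freeze (hG : SmoothOnFibre c s G) :
    ContDiffOn ℝ ∞ (freeze s G) (sliceDomain c s) :=
  ContDiffOn.comp (t := {z | (z, s) ∈ c.e.target}) hG contDiff_fst.contDiffOn fun _ hp ↦ hp.2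

theorem crDeriv_freeze {σ : ℂ} (hs : p.2 = s) (α : Fin n) :
    crDeriv σ (dirZ α) (freeze s G) p = crDeriv σ (dirZ α) G p :=
  crDeriv_congr_slice isOpen_univ (mem_univ p)
    (fun _ _ hq ↦ freeze_apply (hq.trans hs)) rfl

/-- G and H need not be differentiable in the total space. Freezing them in s makes them so without
changing vertical derivatives on the fibre. -/
theorem crDeriv_sub_of_smoothOnFibre {σ : ℂ} (hp : p ∈ c.e.target) (hs : p.2 = s)
    (hG : SmoothOnFibre c s G) (hH : SmoothOnFibre c s H) (α : Fin n) :
    crDeriv σ (dirZ α) (fun q ↦ G q - H q) p =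
      crDeriv σ (dirZ α) G p - crDeriv σ (dirZ α) H p := by
  have hp' := mem_sliceDomain hp hs
  have dG := differentiableAt_of_contDiffOn isOpen_sliceDomain hG.contDiffOn_freeze hp'
  have dH := differentiableAt_of_contDiffOn isOpen_sliceDomain hH.contDiffOn_freeze hp'
  rw [← crDeriv_freeze (G := fun q ↦ G q - H q) hs, ← crDeriv_freeze (G := G) hs,
    ← crDeriv_freeze (G := H) hs, crDeriv_eq dG, crDeriv_eq dH]
  have h1 : freeze s (fun q ↦ G q - H q) = fun q ↦ freeze s G q - freeze s H q := rfl
  rw [h1, crDeriv_eq (dG.fun_sub dH), fderiv_fun_sub dG dH]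
  simp only [sub_apply]
  ring

theorem SmoothOnFibre.sub (hG : SmoothOnFibre c s G) (hH : SmoothOnFibre c s H) :
    SmoothOnFibre c s fun q ↦ G q - H q := ContDiffOn.sub hG hH

theorem isCompact_fibre (F : HolomorphicFamily n X) (hs : s ∈ F.S) :
    IsCompact {x | F.f x = s} := by
  convert F.isProper.isCompact_preimage (isCompact_singleton (x := (⟨s, hs⟩ : F.S))) using 1
  ext x
  simp [Subtype.ext_iff]

theorem vecCoeff_apply {w : ∀ x : X, Tan n x} {x : X} (hx : x ∈ c.e.source) (α : Fin n) :
    vecCoeff c w α (c.e x) = (c.comp x (w x)).1 α := by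
  have h1 : vecCoeff c w α (c.e x) = (fun y ↦ (c.comp y (w y)).1 α) (c.e.symm (c.e x)) := rfl
  rw [h1, c.e.left_inv hx]

namespace RelativeMetric

variable {g : RelativeMetric F} {w : ∀ x : X, Tan n x} {B : VForm F}

open Classical in
/-- The squared length of a vertical vector field. -/
def vertLengthSq (g : RelativeMetric F) (w : ∀ x : X, Tan n x) (x : X) : ℝ :=
  -- The default is never reached on the fibre under study, where w is vertical.
  if h : w x ∈ F.Vert x then (g.form x ⟨w x, h⟩ ⟨w x, h⟩).re else 0

theorem vertLengthSq_eq {x : X} (hx : x ∈ c.e.source) (hxs : F.f x = s) (hw : w x ∈ F.Vert x) :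
    g.vertLengthSq w x =
      (g.lengthSq c (fun α ↦ freeze s (vecCoeff c w α)) (c.e x)).re := by
  have h1 : (c.e x).2 = s := (c.snd_eq x hx).trans hxs
  rw [vertLengthSq, dif_pos hw, g.form_eq_sum c hx, lengthSq]
  simp only [freeze_apply h1, vecCoeff_apply hx, g.coeff_eq_gram c (c.e.map_source hx),
    c.e.left_inv hx]

/-- There are no vector fields `w ≠ 0` on a fibre with `∂̄^* ∂̄ w = 0`. -/
theorem eq_zero_of_isDbarCoclosed (hg : g.IsKahlerEinstein) (hw : IsSmoothLift F s 0 w)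
    (hB : IsDbar s w B) (hco : g.IsDbarCoclosed B s) {x : X} (hx : F.f x = s) : w x = 0 := by
  have hvert : ∀ y, F.f y = s → w y ∈ F.Vert y := fun y hy ↦ LinearMap.mem_ker.2 (hw.1 y hy)
  have hsm : ∀ c : AdaptedChart F, ContDiffOn ℝ ∞
      (g.lengthSq c fun α ↦ freeze s (vecCoeff c w α)) (sliceDomain c s) := fun c ↦
    g.contDiffOn_lengthSq c sliceDomain_subset fun α ↦ (hw.2 c α).contDiffOn_freeze
  have hcont : ContinuousOn (g.vertLengthSq w) {y | F.f y = s} := by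
    intro y hy
    obtain ⟨c, hyc⟩ := exists_adaptedChart F y
    have h1 : c.e y ∈ sliceDomain c s :=
      mem_sliceDomain (c.e.map_source hyc) ((c.snd_eq y hyc).trans hy)
    have h2 : ContinuousAt (fun z ↦
        (g.lengthSq c (fun α ↦ freeze s (vecCoeff c w α)) (c.e z)).re) y :=
      Complex.continuous_re.continuousAt.comp
        (((hsm c).continuousOn.continuousAt (isOpen_sliceDomain.mem_nhds h1)).comp
          (c.e.continuousAt hyc))
    refine h2.continuousWithinAt.congr_of_eventuallyEq ?_ (vertLengthSq_eq hyc hy (hvert y hy))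
    filter_upwards [self_mem_nhdsWithin,
      mem_nhdsWithin_of_mem_nhds (c.e.open_source.mem_nhds hyc)] with z hz hzc
    exact vertLengthSq_eq hzc hz (hvert z hz)
  -- Properness enters here: the length attains its maximum on the compact fibre, and bounding it
  -- there by 0 bounds it everywhere.
  obtain ⟨y, hy, hmax⟩ := (isCompact_fibre F (hx ▸ F.mapsTo x)).exists_isMaxOn ⟨x, hx⟩ hcont
  obtain ⟨c, hyc⟩ := exists_adaptedChart F y
  have hy2 : (c.e y).2 = s := (c.snd_eq y hyc).trans hy
  have hyU : c.e y ∈ sliceDomain c s := mem_sliceDomain (c.e.map_source hyc) hy2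
  have h1 : g.lengthSq c (fun α ↦ freeze s (vecCoeff c w α)) (c.e y) ≤ 0 := by
    refine lengthSq_nonpos c isOpen_sliceDomain sliceDomain_subset hg ⟨c.e y, hyU⟩
      (fun α ↦ (hw.2 c α).contDiffOn_freeze) B (fun α β q hq hqs ↦ ?_) (fun α ↦ ?_)
      fun v hv ↦ ?_
    · rw [hB c q hq.1 (hqs.trans hy2), wirtBar_eq_crDeriv, crDeriv_freeze (hqs.trans hy2)]
    · exact neg_eq_zero.1 (hco c (c.e y) hyU.1 hy2 α)
    · have h2 : ContinuousAt (fun t : ℝ ↦ c.e y + t • v) 0 := by fun_prop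
      filter_upwards [h2.eventually_mem (by simpa using isOpen_sliceDomain.mem_nhds hyU)] with t ht
      have h3 : c.e.symm (c.e y + t • v) ∈ c.e.source := c.e.map_target ht.1
      have h4 : F.f (c.e.symm (c.e y + t • v)) = s := by
        rw [← c.snd_eq _ h3, c.e.right_inv ht.1]
        simp [hv, hy2]
      have h5 : g.vertLengthSq w (c.e.symm (c.e y + t • v)) ≤ g.vertLengthSq w y := hmax h4
      rw [vertLengthSq_eq h3 h4 (hvert _ h4), vertLengthSq_eq hyc hy (hvert _ hy),
        c.e.right_inv ht.1] at h5
      simpa using h5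
  have h2 : g.vertLengthSq w x ≤ 0 := by
    refine le_trans (b := g.vertLengthSq w y) (hmax hx) ?_
    rw [vertLengthSq_eq hyc hy (hvert _ hy)]
    exact (Complex.le_def.1 h1).1
  by_contra h0
  have h3 := g.pos x ⟨w x, hvert x hx⟩ fun h ↦ h0 (congrArg Subtype.val h)
  rw [vertLengthSq, dif_pos (hvert x hx)] at h2
  exact absurd h2 (not_le.2 h3)

theorem coeff_sub (A B : VForm F) (c : AdaptedChart F) (α β : Fin n) :
    VForm.coeff (F := F) (fun x ↦ A x - B x) c α β = fun p ↦ A.coeff c α β p - B.coeff c α β p := by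
  ext p
  simp [VForm.coeff]

theorem vecCoeff_sub (u w : ∀ x : X, Tan n x) (c : AdaptedChart F) (α : Fin n) :
    vecCoeff c (fun x ↦ u x - w x) α = fun p ↦ vecCoeff c u α p - vecCoeff c w α p := by
  ext p
  simp [vecCoeff]

theorem IsDbarCoclosed.sub {A B : VForm F} (hA : A.IsSmooth s) (hB : B.IsSmooth s)
    (hA' : g.IsDbarCoclosed A s) (hB' : g.IsDbarCoclosed B s) :
    g.IsDbarCoclosed (fun x ↦ A x - B x) s := by
  intro c p hp hs α
  have h1 : ∀ β γ, g.covDeriv (fun x ↦ A x - B x) c p α β γ =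
      g.covDeriv A c p α β γ - g.covDeriv B c p α β γ := by
    intro β γ
    simp only [covDeriv, coeff_sub, wirt_eq_crDeriv]
    rw [crDeriv_sub_of_smoothOnFibre hp hs (hA c α β) (hB c α β)]
    simp only [mul_sub, Finset.sum_sub_distrib]
    ring
  simp only [h1, mul_sub, Finset.sum_sub_distrib, neg_sub]
  have h2 := hA' c p hp hs α
  have h3 := hB' c p hp hs α
  linear_combination h2 - h3

theorem _root_.KEFamily.IsSmoothLift.sub {a b : ℂ} {u w : ∀ x : X, Tan n x}
    (hu : IsSmoothLift F s a u) (hw : IsSmoothLift F s b w) :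
    IsSmoothLift F s (a - b) fun x ↦ u x - w x :=
  ⟨fun x hx ↦ by rw [map_sub, hu.1 x hx, hw.1 x hx], fun c α ↦ by
    rw [vecCoeff_sub]; exact (hu.2 c α).sub (hw.2 c α)⟩

theorem _root_.KEFamily.IsDbar.sub {a b : ℂ} {u w : ∀ x : X, Tan n x} {A B : VForm F}
    (hu : IsSmoothLift F s a u) (hw : IsSmoothLift F s b w) (hA : IsDbar s u A)
    (hB : IsDbar s w B) : IsDbar s (fun x ↦ u x - w x) (fun x ↦ A x - B x : VForm F) := by
  intro c p hp hs α β
  rw [coeff_sub, vecCoeff_sub, wirtBar_eq_crDeriv,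
    crDeriv_sub_of_smoothOnFibre hp hs (hu.2 c α) (hw.2 c α), ← wirtBar_eq_crDeriv,
    ← hA c p hp hs, ← hB c p hp hs]

theorem _root_.KEFamily.IsDbar.eq_zero (hB : IsDbar s w B) (hw : ∀ x, F.f x = s → w x = 0) {x : X}
    (hx : F.f x = s) : B x = 0 := by
  obtain ⟨c, hxc⟩ := exists_adaptedChart F x
  obtain ⟨p, hp, rfl⟩ : ∃ p ∈ c.e.target, c.e.symm p = x :=
    ⟨c.e x, c.e.map_source hxc, c.e.left_inv hxc⟩
  have hs : p.2 = s := by rw [← hx, ← c.snd_eq _ hxc, c.e.right_inv hp]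
  have h1 : ∀ β, B (c.e.symm p) (c.partialZ β p) = 0 := by
    intro β
    refine c.vert_ext hxc fun α ↦ ?_
    have h2 := hB c p hp hs α β
    rw [wirtBar_eq_crDeriv, crDeriv_congr_slice (H := fun _ ↦ 0) c.e.open_target hp
      (fun q hq hqs ↦ ?_) rfl, crDeriv_const] at h2
    · rw [Submodule.coe_zero, map_zero]
      exact h2
    · have h3 : F.f (c.e.symm q) = s := by
        rw [← c.snd_eq _ (c.e.map_target hq), c.e.right_inv hq, hqs, hs]
      simp [vecCoeff, hw _ h3]
  ext1 u
  rw [c.eq_sum_frame hxc u, map_sum, LinearMap.zero_apply]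
  refine Finset.sum_eq_zero fun β _ ↦ ?_
  rw [map_smulₛₗ, ← c.partialZ_eq_frame hp, h1, smul_zero]

/-- The harmonic representative of the Kodaira-Spencer class is unique. -/
theorem isHarmonicKodairaSpencer_unique (hg : g.IsKahlerEinstein) {v : ∀ x : X, Tan n x}
    {A B : VForm F} (hv : IsSmoothLift F s 1 v) (hA : IsDbar s v A) (hAs : A.IsSmooth s)
    (hAco : g.IsDbarCoclosed A s) (hB : g.IsHarmonicKodairaSpencer s B) {x : X}
    (hx : F.f x = s) : B x = A x := by
  obtain ⟨⟨hBs, -, u, B₀, hu, hB₀, w, C, hw, hC, hBC⟩, hBco⟩ := hB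
  -- B is ∂̄u + ∂̄w on the fibre, so A - B = ∂̄(v - u - w). The s-component 1 - 1 - 0 vanishes, so
  -- this field is vertical and the vanishing result applies.
  have h1 := (hv.sub hu).sub hw
  rw [sub_self, sub_zero] at h1
  have h2 := IsDbar.sub (hv.sub hu) hw (IsDbar.sub hv hu hA hB₀) hC
  have h3 : IsDbar s (fun x ↦ v x - u x - w x) (fun x ↦ A x - B x : VForm F) := by
    intro c p hp hs α β
    rw [← h2 c p hp hs α β]
    have h4 : F.f (c.e.symm p) = s := by
      rw [← c.snd_eq _ (c.e.map_target hp), c.e.right_inv hp, hs]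
    have h5 : A (c.e.symm p) - B (c.e.symm p) =
        A (c.e.symm p) - B₀ (c.e.symm p) - C (c.e.symm p) := by
      rw [← hBC _ h4]
      abel
    simp only [VForm.coeff, h5]
  have h6 := h3.eq_zero (fun y hy ↦ eq_zero_of_isDbarCoclosed hg h1 h3
    (IsDbarCoclosed.sub hAs hBs hAco hBco) hy) hx
  exact (sub_eq_zero.1 h6).symm

end RelativeMetric
end Uniqueness

end KEFamily

end

theorem proposition2 {n : ℕ} {X : Type*} [TopologicalSpace X] [T2Space X]
    [ChartedSpace (KEFamily.Model n) X] [IsManifold 𝓘(ℂ, KEFamily.Model n) ω X]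
    (F : KEFamily.HolomorphicFamily n X) (g : KEFamily.RelativeMetric F)
    (hg : g.IsKahlerEinstein) :
    -- `∂/∂s` has a unique horizontal lift `v`
    (∀ x : X, ∃! v : KEFamily.Tan n x, g.IsHorizontalLift x v) ∧
    ∀ (v : ∀ x : X, KEFamily.Tan n x) (_ : ∀ x, g.IsHorizontalLift x (v x))
      (φ : X → ℂ) (_ : ∀ x, φ x = g.omega x (v x) (v x)),
      -- `φ` is a real valued smooth function on the total space
      (∀ x, (φ x).im = 0) ∧
      (∀ c : KEFamily.AdaptedChart F, ContDiffOn ℝ ∞ (φ ∘ c.e.symm) c.e.target) ∧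
      ∀ s ∈ F.S, ∃ A : KEFamily.VForm F,
        -- `A` is the unique harmonic representative of `ρ_s(∂/∂s)`, and it is `∂̄ v`
        g.IsHarmonicKodairaSpencer s A ∧
        (∀ B : KEFamily.VForm F, g.IsHarmonicKodairaSpencer s B →
          ∀ x, F.f x = s → B x = A x) ∧
        KEFamily.IsDbar s v A ∧
        -- the elliptic equation on the fibre over `s`
        ∀ c : KEFamily.AdaptedChart F, ∀ p ∈ c.e.target, p.2 = s →
          g.laplacian c φ p + φ (c.e.symm p) = g.normSq c A p := by
  open KEFamily RelativeMetric in
  refine ⟨existsUnique_horizontalLift hg, fun v hv φ hφ ↦ ⟨fun x ↦ ?_,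
    fun c ↦ contDiffOn_omega_self c hg hv hφ, fun s _ ↦ ?_⟩⟩
  · rw [hφ]
    exact omega_self_im g x (v x)
  · have h1 := representsKodairaSpencer_dbarForm hg hv s
    have h2 := isDbarCoclosed_dbarForm hg hv s
    have h3 := isDbar_dbarForm hg hv s
    exact ⟨dbarForm v, ⟨h1, h2⟩, fun B hB x hx ↦ isHarmonicKodairaSpencer_unique hg
      ⟨fun x _ ↦ (hv x).1, fun c α ↦ smoothOnFibre_of_contDiffOn c
        (contDiffOn_vecCoeff c hg hv α) s⟩ h3 h1.1 h2 hB hx, h3,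
      fun c p hp _ ↦ elliptic c hg hv hφ hp fun α β ↦ coeff_dbarForm c hg hv hp α β⟩
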